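/- **Conventions.** Let $L$ be a relational language, possibly infinite, all of whose symbols have arity at least $1$; all structures have finite or countable vertex sets. Substructures are induced. A structure is *irreducible* if any two distinct vertices lie in a common tuple of some relation. A *homomorphism-embedding* is a homomorphism whose restriction to every irreducible substructure is an embedding. For a family $\mathcal F$ of finite structures, $\mathrm{Forb}(\mathcal F)$ is the class of finite or countable $L$-structures $A$ that admit no homomorphism-embedding $F\to A$ with $F\in\mathcal F$. The family $\mathcal F$ is *closed for homomorphism-embedding images* if for every $F\in\mathcal F$ and every surjective homomorphism-embedding $f:F\to B$ there are $F''\in\mathcal F$ and an injective homomorphism-embedding $F''\to B$. The *Gaifman graph* of $A$ joins distinct vertices that lie in a common tuple; $A$ is *connected* if this graph is connected (in particular non-empty); $N_A(S)$ is the set of vertices outside $S$ adjacent to $S$. *Pieces.* Let $A$ be connected and let $R$ be a set of vertices such that there are two different components $C\ne C'$ of the Gaifman graph of $A$ with $R$ removed satisfying $N_A(C)=N_A(C')=R$. The structure induced by $A$ on $C\cup R$, rooted at an enumeration $\vec R$ of $R$, is a *piece* of $A$ of *width* $|R|$. A rooted structure $Q$ (rooted at a tuple of distinct vertices) is *incompatible*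 with a piece $P$ of the same width if the free amalgamation $P\oplus Q$ along the roots is defined and is isomorphic to a member of $\mathcal F$. Two pieces of members of $\mathcal F$ are *equivalent*, $P\sim_{\mathcal F}P'$, if they have the same width and the same incompatible rooted structures. $\mathcal F$ is *regular* if $\sim_{\mathcal F}$ has finitely many classes of width $n$ for each $n\ge1$. *Lifts.* The language $L^+$ adds to $L$, for each class $c$ of $\sim_{\mathcal F}$, a relation symbol whose arity is the width of $c$. The *shadow* of an $L^+$-structure is its $L$-reduct. The *canonical lift* $L_{\mathcal F}(A)$ of $A$ puts a tuple $\vec v$ of distinct vertices in the relation of $c$ if and only if some piece $(P,\vec R)\in c$ has a homomorphism-embedding $f:P\to A$ with $f(\vec R)=\vec v$. It is *maximal on* $S\subseteq A$ if for every $C\in\mathrm{Forb}(\mathcal F)$ containing $A$ as a substructure $L_{\mathcal F}(A)$ and $L_{\mathcal F}(C)$ induce the same $L^+$-structure on $S$. A *maximal $\mathcal F$-lift* is an $L^+$-structure induced by some $L_{\mathcal F}(A)$, $A\in\mathrm{Forb}(\mathcal F)$, on a set of vertices on which $L_{\mathcal F}(A)$ is maximal. Let $\mathcal L_{\mathcal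 F}$ be the class of finite maximal $\mathcal F$-lifts, and let $\mathrm{Age}(\mathcal L_{\mathcal F})$ be the class of finite structures that embed in a member of $\mathcal L_{\mathcal F}$. **Theorem.** Let $\mathcal F$ be a family of finite connected $L$-structures that is closed for homomorphism-embedding images, and assume that $\sim_{\mathcal F}$ has at most countably many classes. 1. $\mathrm{Age}(\mathcal L_{\mathcal F})$ is an amalgamation class (of finite structures, with the hereditary, joint embedding and amalgamation properties). Moreover, for all embeddings $\alpha_i:A\to B_i$ ($i=1,2$) in it there is a strong amalgamation $C\in \mathrm{Age}(\mathcal L_{\mathcal F})$ of $B_1$ and $B_2$ over $A$ whose shadow is the free amalgamation of the shadows of $B_1$ and $B_2$ over the shadow of $A$. 2. If $\mathcal F$ is regular, then $L^+$ has finitely many new symbols of each arity, and $\mathrm{Age}(\mathcal L_{\mathcal F})$ is a precompact lift of the class of finite structures in $\mathrm{Forb}(\mathcal F)$: the shadows of its members are, up to isomorphism, exactly the finite structures in $\mathrm{Forb}(\mathcal F)$, and each such structure is the shadow of only finitely many members, up to isomorphism. 3. If $\mathcal L_{\mathcal F}$ has only countably many isomorphism types, then $\mathrm{Age}(\mathcal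 L_{\mathcal F})$ has a Fraïssé limit $U'$ (a countable ultrahomogeneous structure with this age). 4. If $\mathcal F$ is regular and $L$ is finite, then $\mathcal L_{\mathcal F}$ has countably many isomorphism types, and the shadow $U$ of the Fraïssé limit $U'$ belongs to $\mathrm{Forb}(\mathcal F)$, is $\omega$-categorical (for each $n$ its automorphism group has finitely many orbits on $n$-tuples), is existentially complete in $\mathrm{Forb}(\mathcal F)$ (every existential statement with parameters in $U$ that holds in some $B\in\mathrm{Forb}(\mathcal F)$ containing $U$ as a substructure holds in $U$), and every member of $\mathrm{Forb}(\mathcal F)$ embeds in $U$. Up to isomorphism $U$ is the only $\omega$-categorical, existentially complete, universal structure in $\mathrm{Forb}(\mathcal F)$. -/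

import Mathlib

open CategoryTheory FirstOrder

universe u v

namespace MaximalLifts

/-- An `L`-structure on a vertex set (`L` will always be a relational language). -/
abbrev Str (L : FirstOrder.Language.{u, v}) := Bundled.{0} L.Structure

variable {L : FirstOrder.Language.{u, v}}

/-! ### Irreducible sets, homomorphism-embeddings, the Gaifman graph -/

/-- The set `S` of vertices induces an irreducible structure: any two distinct vertices of `S` lie
in a common tuple (of some relation) all of whose entries belong to `S`. -/
def IsIrreducibleOn (A : Str L) (S : Set A) : Prop :=
  ∀ x ∈ S, ∀ y ∈ S, x ≠ y → ∃ (n : ℕ) (R : L.Relations n) (t : Fin n → A),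
    FirstOrder.Language.Structure.RelMap R t ∧ (∀ i, t i ∈ S) ∧ x ∈ Set.range t ∧ y ∈ Set.range t

/-- Homomorphism-embeddings: homomorphisms whose restriction to every irreducible (induced)
substructure is an embedding. -/
structure IsHomEmb {A B : Str L} (f : A → B) : Prop where
  map_rel : ∀ (n : ℕ) (R : L.Relations n) (t : Fin n → A),
    FirstOrder.Language.Structure.RelMap R t → FirstOrder.Language.Structure.RelMap R (f ∘ t)
  injOn : ∀ S : Set A, IsIrreducibleOn A S → Set.InjOn f S
  reflect_rel : ∀ S : Set A, IsIrreducibleOn A S →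
    ∀ (n : ℕ) (R : L.Relations n) (t : Fin n → A), (∀ i, t i ∈ S) →
      FirstOrder.Language.Structure.RelMap R (f ∘ t) → FirstOrder.Language.Structure.RelMap R t

/-- The Gaifman graph: distinct vertices are adjacent when they lie in a common tuple. -/
def gaifman (A : Str L) : SimpleGraph A where
  Adj x y := x ≠ y ∧ ∃ (n : ℕ) (R : L.Relations n) (t : Fin n → A),
    FirstOrder.Language.Structure.RelMap R t ∧ x ∈ Set.range t ∧ y ∈ Set.range t
  symm := ⟨fun _ _ ⟨h, n, R, t, ht, hx, hy⟩ => ⟨h.symm, n, R, t, ht, hy, hx⟩⟩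
  loopless := ⟨fun _ h => h.1 rfl⟩

/-- Connected structures (in particular they are non-empty). -/
def IsConnectedStr (A : Str L) : Prop := (gaifman A).Connected

/-- The neighbourhood of a set of vertices, in the Gaifman graph. -/
def neighbourhood (A : Str L) (S : Set A) : Set A :=
  {x | x ∉ S ∧ ∃ y ∈ S, (gaifman A).Adj x y}

/-- `C` is (the vertex set of) a connected component of `A` after the removal of `R`. -/
def IsComponent (A : Str L) (R C : Set A) : Prop :=
  ∃ c : ((gaifman A).induce Rᶜ).ConnectedComponent, C = Subtype.val '' c.supp

/-- `R` is a minimal separating cut for its component `C`: there is another component `C'` with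
`R = N(C) = N(C')`. -/
def IsMinimalSeparating (A : Str L) (R C : Set A) : Prop :=
  IsComponent A R C ∧ neighbourhood A C = R ∧
    ∃ C' : Set A, IsComponent A R C' ∧ C' ≠ C ∧ neighbourhood A C' = R

/-! ### Amalgamations -/

/-- `β₁, β₂` (embeddings, in all uses) form a strong amalgamation of `B₁` and `B₂` over `A` with
respect to `α₁, α₂`: they agree on `A`, and their images overlap in the copy of `A` only. -/
def IsStrongAmalgam {A B₁ B₂ C : Type*} (α₁ : A → B₁) (α₂ : A → B₂) (β₁ : B₁ → C) (β₂ : B₂ → C) :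
    Prop :=
  (∀ a, β₁ (α₁ a) = β₂ (α₂ a)) ∧ ∀ x₁ x₂, β₁ x₁ = β₂ x₂ → ∃ a, α₁ a = x₁ ∧ α₂ a = x₂

/-- A free amalgamation: a strong amalgamation whose vertices all come from `B₁` or `B₂` and none
of whose tuples contains both a vertex of `B₁ ∖ A` and a vertex of `B₂ ∖ A`. -/
def IsFreeAmalgam {A B₁ B₂ : Type*} (C : Str L) (α₁ : A → B₁) (α₂ : A → B₂)
    (β₁ : B₁ → C) (β₂ : B₂ → C) : Prop :=
  IsStrongAmalgam α₁ α₂ β₁ β₂ ∧ (∀ c, c ∈ Set.range β₁ ∨ c ∈ Set.range β₂) ∧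
    ∀ (n : ℕ) (R : L.Relations n) (t : Fin n → C), FirstOrder.Language.Structure.RelMap R t →
      ¬ ∃ i j, t i ∈ β₁ '' (Set.range α₁)ᶜ ∧ t j ∈ β₂ '' (Set.range α₂)ᶜ

/-! ### Pieces -/

/-- A structure rooted at a tuple of `n` distinct vertices. -/
structure Rooted (L : FirstOrder.Language.{u, v}) (n : ℕ) where
  /-- the underlying structure -/
  str : Str L
  /-- the root -/
  root : Fin n ↪ str

/-- `P` is (isomorphic to) a piece of the connected structure `A`: the structure induced on
`C ∪ R`, rooted at an enumeration of `R`, where `R` is a minimal separating cut for `C`. -/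
def IsPiece {n : ℕ} (P : Rooted L n) (A : Str L) : Prop :=
  IsConnectedStr A ∧ ∃ (R C : Set A) (e : P.str ↪[L] A), IsMinimalSeparating A R C ∧
    Set.range e = C ∪ R ∧ Set.range (e ∘ P.root) = R

/-- `A` is isomorphic to the free amalgamation `P ⊕ Q` along the roots. -/
def IsRootedSum {n : ℕ} (P Q : Rooted L n) (A : Str L) : Prop :=
  ∃ (e₁ : P.str ↪[L] A) (e₂ : Q.str ↪[L] A), IsFreeAmalgam A P.root Q.root e₁ e₂

/-- The rooted structures incompatible with `P` (with respect to the family `F`). -/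
def incompatible (F : Set (Str L)) {n : ℕ} (P : Rooted L n) : Set (Rooted L n) :=
  {Q | ∃ A ∈ F, IsRootedSum P Q A}

/-- The pieces of width `n` of members of `F`. -/
def Piece (F : Set (Str L)) (n : ℕ) := {P : Rooted L n // ∃ A ∈ F, IsPiece P A}

/-- The piece equivalence `∼_F` on pieces of width `n`. -/
def pieceSetoid (F : Set (Str L)) (n : ℕ) : Setoid (Piece F n) :=
  Setoid.ker fun P : Piece F n => incompatible F P.1

/-- The classes of width `n` of the piece equivalence. -/
def PieceClass (F : Set (Str L)) (n : ℕ) := Quotient (pieceSetoid F n)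

/-- Regular families: finitely many classes of pieces of each width. -/
def IsRegular (F : Set (Str L)) : Prop := ∀ n : ℕ, 1 ≤ n → Finite (PieceClass F n)

/-! ### The class `Forb(F)` -/

/-- The finite or countable structures that admit no homomorphism-embedding from a member
of `F`. -/
def Forb (F : Set (Str L)) : Set (Str L) :=
  {A | Countable A ∧ ∀ B ∈ F, ¬ ∃ f : B → A, IsHomEmb f}

/-- `F` is closed for homomorphism-embedding images: every image `B` of a member of `F` under a
surjective homomorphism-embedding contains a member of `F`, in the sense that some member of `F`
has an injective homomorphism-embedding to `B` (by any embedding, in particular). -/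
def ClosedForHomEmbImages (F : Set (Str L)) : Prop :=
  ∀ A ∈ F, ∀ (B : Str L) (f : A → B), IsHomEmb f → Function.Surjective f →
    ∃ A' ∈ F, ∃ g : A' → B, IsHomEmb g ∧ Function.Injective g

/-! ### Lifts -/

/-- The new symbols: one symbol of arity `n` for each class of pieces of width `n`. -/
def extLang (F : Set (Str L)) : FirstOrder.Language where
  Functions := fun _ => Empty
  Relations := fun n => PieceClass F n

instance (F : Set (Str L)) : (extLang F).IsRelational := fun _ => inferInstanceAs (IsEmpty Empty)

/-- The lifted language `L⁺`. -/
abbrev liftLang (F : Set (Str L)) : FirstOrder.Language := L.sum (extLang F)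

instance [L.IsRelational] : Countable (Σ n, L.Functions n) := inferInstance

/-- The shadow of a lift. -/
def shadow {F : Set (Str L)} (X : Str (liftLang F)) : Str L :=
  ⟨X, (FirstOrder.Language.LHom.sumInl : L →ᴸ liftLang F).reduct X⟩

/-- The tuple `t` is in the new relation `c` of the canonical lift of `A`: some piece of the
class `c` has a homomorphism-embedding to `A` that maps its root injectively onto `t`. -/
def InCanonicalLift (F : Set (Str L)) (A : Str L) {n : ℕ} (c : PieceClass F n) (t : Fin n → A) :
    Prop :=
  ∃ P : Piece F n, Quotient.mk (pieceSetoid F n) P = c ∧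
    ∃ f : P.1.str → A, IsHomEmb f ∧ f ∘ P.1.root = t ∧ Function.Injective t

/-- The new relations of the canonical lift of `A`. -/
abbrev extStructure (F : Set (Str L)) (A : Str L) : (extLang F).Structure A where
  funMap := fun f => Empty.elim f
  RelMap := fun c t => InCanonicalLift F A c t

/-- The canonical `F`-lift of `A`. -/
def canonicalLift (F : Set (Str L)) (A : Str L) : Str (liftLang F) :=
  ⟨A, @FirstOrder.Language.sumStructure L (extLang F) A A.str (extStructure F A)⟩

/-- The canonical lift of `A` is maximal on the set `S` of vertices: for each `C` in `Forb(F)`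
that contains `A` as a substructure, the canonical lifts of `A` and of `C` induce the same lift
on `S`. -/
def IsMaximalOn (F : Set (Str L)) (A : Str L) (S : Set A) : Prop :=
  ∀ C ∈ Forb F, ∀ e : A ↪[L] C, ∀ (n : ℕ) (c : PieceClass F n) (t : Fin n → A),
    (∀ i, t i ∈ S) → (InCanonicalLift F A c t ↔ InCanonicalLift F C c (e ∘ t))

/-- Maximal `F`-lifts: those induced by the canonical lift of some witness `A` in `Forb(F)` whose
canonical lift is maximal on the vertices of `X`. -/
def IsMaximalLift (F : Set (Str L)) (X : Str (liftLang F)) : Prop :=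
  ∃ A ∈ Forb F, ∃ e : X ↪[liftLang F] canonicalLift F A, IsMaximalOn F A (Set.range e)

/-- The class of all finite maximal `F`-lifts. -/
def Lifts (F : Set (Str L)) : Set (Str (liftLang F)) := {X | Finite X ∧ IsMaximalLift F X}

/-! ### Classes of structures -/

/-- The age of a class of structures. -/
def ageOf (K : Set (Str L)) : Set (Str L) := ⋃ A ∈ K, L.age A

/-- Amalgamation classes of finite structures. -/
structure IsAmalgamationClass (K : Set (Str L)) : Prop where
  finite : ∀ A ∈ K, Finite A
  hereditary : FirstOrder.Language.Hereditary K
  jointEmbedding : FirstOrder.Language.JointEmbedding K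
  amalgamation : FirstOrder.Language.Amalgamation K

/-- In the class `K` of lifts, every amalgamation diagram has a strong amalgamation whose shadow
is the free amalgamation of the shadows. -/
def HasAmalgamsWithFreeShadows {F : Set (Str L)} (K : Set (Str (liftLang F))) : Prop :=
  ∀ A ∈ K, ∀ B₁ ∈ K, ∀ B₂ ∈ K, ∀ (α₁ : A ↪[liftLang F] B₁) (α₂ : A ↪[liftLang F] B₂),
    ∃ C ∈ K, ∃ (β₁ : B₁ ↪[liftLang F] C) (β₂ : B₂ ↪[liftLang F] C),
      IsStrongAmalgam α₁ α₂ β₁ β₂ ∧ IsFreeAmalgam (shadow C) α₁ α₂ β₁ β₂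

/-- The class of lifts `K'` is a precompact lift of the class `K`: the shadows of members of `K'`
are, up to isomorphism, the members of `K`, and each member of `K` has, up to isomorphism, only
finitely many lifts in `K'`. -/
def IsPrecompactLift {F : Set (Str L)} (K' : Set (Str (liftLang F))) (K : Set (Str L)) : Prop :=
  (∀ A : Str L, A ∈ K ↔ ∃ X ∈ K', Nonempty (shadow X ≃[L] A)) ∧
    ∀ A ∈ K, (Quotient.mk (FirstOrder.Language.equivSetoid (L := liftLang F)) ''
      {X | X ∈ K' ∧ Nonempty (shadow X ≃[L] A)}).Finite

/-- A class with countably many isomorphism types. -/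
def EssentiallyCountable (K : Set (Str L)) : Prop :=
  (Quotient.mk (FirstOrder.Language.equivSetoid (L := L)) '' K).Countable

/-- `ω`-categoricity: for each `n`, the automorphism group has finitely many orbits
on `n`-tuples. -/
def IsOmegaCategorical (U : Str L) : Prop :=
  ∀ n : ℕ, ∃ T : Set (Fin n → U), T.Finite ∧
    ∀ t : Fin n → U, ∃ g : U ≃[L] U, (fun i => g (t i)) ∈ T

/-- `U` is existentially complete in `K`: existential statements with parameters in `U` that hold
in an extension of `U` belonging to `K` hold in `U`. -/
def IsExistentiallyComplete (K : Set (Str L)) (U : Str L) : Prop :=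
  U ∈ K ∧ ∀ B ∈ K, ∀ (e : U ↪[L] B) (φ : L.Formula U),
    FirstOrder.Language.BoundedFormula.IsExistential φ → φ.Realize (fun a => e a) → φ.Realize (fun a => a)

/-- `U` is (embedding-)universal for `K`. -/
def IsUniversal (K : Set (Str L)) (U : Str L) : Prop := ∀ A ∈ K, Nonempty (A ↪[L] U)

/-- `U'` is a Fraïssé limit of `K`: countable, ultrahomogeneous, and with age `K`. -/
def IsLimit [Countable (Σ n, L.Functions n)] (K : Set (Str L)) (U : Str L) : Prop :=
  ∃ _ : Countable U, FirstOrder.Language.IsFraisseLimit K U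

end MaximalLifts

/-! Everything rests on `IsFreeAmalgam.mem_Forb`: a free amalgamation of `W₁` and `W₂` from `Forb F`
stays in `Forb F` when each new tuple that `W₁` has on the common part is also present in `W₂`, and
`W₁` is maximal there. Pieces are designed for this. A minimal separating cut writes a member of `F`
as `P ⊕ Q`, and piece equivalence allows `P` to be exchanged for any equivalent `P'`, with `P' ⊕ Q`
again in `F` up to isomorphism (`exists_exchange`).

Suppose some `A ∈ F` maps to the amalgamation, with as few image vertices outside `W₁` as possible;
closure under images makes the map injective. Off the preimage of the common part, choose a
component `C₀` that leaves `W₁`; all of it is mapped to `W₂`. Let `C` be a component of `A` without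
`N(C₀)` that leaves `W₂`. Then `C` is mapped into `W₁`. Otherwise, by minimality, `W₁` together with
the image of `C` is in `Forb F`; by maximality the class of the piece on `C` is already recorded in
`W₁`, and exchanging that piece for one inside `W₁` contradicts minimality. So the class of each
such piece is recorded in `W₁` on the common part, hence in `W₂`. Exchanging all these pieces for
pieces inside `W₂` (`IsStrongAmalgam.false_of_components`) would map a member of `F` to `W₂`, which
is impossible.

Maximal witnesses exist by a countable saturation (`exists_isMaximalOn`). Amalgamating two witnesses
freely and extending the result to a maximal one amalgamates the lifts.

The limit `U'` is the canonical lift of its shadow, and no extension in `Forb F` adds new tuples on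
it (`IsLimit.newRel_iff`), because each finite part has a witness inside the shadow. Extensions in
`Forb F` can therefore be embedded back over finitely many parameters, which gives existential
completeness; universality is the case of no parameters. For finite `L` and regular `F` there are
finitely many types of `n`-tuples, and homogeneity turns types into orbits.

For uniqueness, an existentially complete `V` has a maximal canonical lift, since pieces are finite.
A back-and-forth argument with `U'` uses homogeneity in one direction. In the other, `V` and the
shadow of `U'` are amalgamated freely over a finite tuple, existential completeness copies the
finite parts of the shadow into `V`, and `ω`-categoricity passes from finite parts to the whole. -/

namespace MaximalLifts

open FirstOrder.Language.Structure (RelMap)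

variable {L : FirstOrder.Language.{u, v}}

/-! ### Relational structures -/

/-- A map into the range of an embedding factors through it. -/
theorem exists_factor {X A B : Type*} [L.Structure A] [L.Structure B] (e : A ↪[L] B) (f : X → B)
    (h : ∀ x, f x ∈ Set.range e) : ∃ g : X → A, ∀ x, e (g x) = f x :=
  ⟨fun x => (h x).choose, fun x => (h x).choose_spec⟩

section Relational

variable [L.IsRelational]

/-- An injective map that preserves and reflects the relations is an embedding. -/
def mkEmb {A B : Type*} [L.Structure A] [L.Structure B] (f : A → B) (hf : Function.Injective f)
    (h : ∀ (n : ℕ) (R : L.Relations n) (t : Fin n → A), RelMap R (f ∘ t) ↔ RelMap R t) :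
    A ↪[L] B where
  toFun := f
  inj' := hf
  map_fun' := fun g => isEmptyElim g
  map_rel' := fun {n} R t => h n R t

/-- The structure induced on a set of vertices. -/
def induce (A : Str L) (S : Set A) : Str L :=
  ⟨S, { funMap := fun g => isEmptyElim g, RelMap := fun R t => RelMap R fun i => (t i : A) }⟩

/-- The inclusion of an induced substructure. -/
def induceEmb (A : Str L) (S : Set A) : induce A S ↪[L] A :=
  mkEmb (A := induce A S) (fun x : S => (x : A)) Subtype.val_injective fun _ _ _ => Iff.rfl

theorem induceEmb_mem (A : Str L) (S : Set A) (x : induce A S) : induceEmb A S x ∈ S := x.2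

theorem range_induceEmb (A : Str L) (S : Set A) : Set.range (induceEmb A S) = S :=
  Subtype.range_coe

/-- An embedding whose range lies in the range of another embedding factors through it. -/
theorem exists_factor_embedding {X A B : Type*} [L.Structure X] [L.Structure A] [L.Structure B]
    (e : A ↪[L] B) (f : X ↪[L] B) (h : ∀ x, f x ∈ Set.range e) :
    ∃ g : X ↪[L] A, ∀ x, e (g x) = f x := by
  obtain ⟨g, hg⟩ := exists_factor e f h
  have hg' : e ∘ g = f := funext hg
  refine ⟨mkEmb g (fun x y hxy => f.injective ?_) fun n R t => ?_, hg⟩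
  · rw [← hg, ← hg, hxy]
  · rw [← e.map_rel, ← f.map_rel, ← hg', Function.comp_assoc]

end Relational

/-! ### Homomorphism-embeddings -/

theorem IsIrreducibleOn.image {A B : Str L} {f : A → B}
    (hf : ∀ (n : ℕ) (R : L.Relations n) (t : Fin n → A), RelMap R t → RelMap R (f ∘ t))
    {S : Set A} (hS : IsIrreducibleOn A S) : IsIrreducibleOn B (f '' S) := by
  rintro _ ⟨x, hx, rfl⟩ _ ⟨y, hy, rfl⟩ hxy
  obtain ⟨n, R, t, ht, htS, ⟨i, rfl⟩, ⟨j, rfl⟩⟩ := hS x hx y hy fun h => hxy (h ▸ rfl)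
  exact ⟨n, R, f ∘ t, hf n R t ht, fun k => ⟨t k, htS k, rfl⟩, ⟨i, rfl⟩, ⟨j, rfl⟩⟩

theorem IsHomEmb.comp {A B C : Str L} {g : B → C} {f : A → B} (hg : IsHomEmb g)
    (hf : IsHomEmb f) : IsHomEmb (g ∘ f) where
  map_rel n R t ht := hg.map_rel n R _ (hf.map_rel n R t ht)
  injOn S hS := (hg.injOn _ (hS.image hf.map_rel)).comp (hf.injOn S hS) (Set.mapsTo_image f S)
  reflect_rel S hS n R t htS ht := hf.reflect_rel S hS n R t htS
    (hg.reflect_rel _ (hS.image hf.map_rel) n R (f ∘ t) (fun i => ⟨t i, htS i, rfl⟩) ht)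

theorem isHomEmb_embedding {A B : Str L} (e : A ↪[L] B) : IsHomEmb e where
  map_rel _ R t ht := (e.map_rel R t).2 ht
  injOn _ _ := e.injective.injOn
  reflect_rel _ _ _ R t _ ht := (e.map_rel R t).1 ht

theorem IsHomEmb.comp_embedding {A B C : Str L} {g : B → C} (hg : IsHomEmb g) (e : A ↪[L] B) :
    IsHomEmb fun x => g (e x) := hg.comp (isHomEmb_embedding e)

theorem IsHomEmb.embedding_comp {A B C : Str L} (e : B ↪[L] C) {f : A → B} (hf : IsHomEmb f) :
    IsHomEmb fun x => e (f x) := (isHomEmb_embedding e).comp hf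

theorem IsHomEmb.of_embedding_comp {A B C : Str L} (e : B ↪[L] C) {f : A → B}
    (h : IsHomEmb fun x => e (f x)) : IsHomEmb f where
  map_rel n R t ht := (e.map_rel R _).1 (h.map_rel n R t ht)
  injOn S hS _ hx _ hy hxy := h.injOn S hS hx hy (congrArg e hxy)
  reflect_rel S hS n R t htS ht := h.reflect_rel S hS n R t htS ((e.map_rel R _).2 ht)

theorem IsHomEmb.exists_factor [L.IsRelational] {A B C : Str L} (e : B ↪[L] C) {f : A → C}
    (hf : IsHomEmb f) (h : ∀ x, f x ∈ Set.range e) :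
    ∃ g : A → B, IsHomEmb g ∧ ∀ x, e (g x) = f x := by
  obtain ⟨g, hg⟩ := MaximalLifts.exists_factor e f h
  exact ⟨g, IsHomEmb.of_embedding_comp e (by simpa only [hg] using hf), hg⟩

/-! ### The class `Forb(F)` -/

theorem Forb.of_embedding {F : Set (Str L)} {A B : Str L} (hB : B ∈ Forb F) (e : A ↪[L] B) :
    A ∈ Forb F := by
  have := hB.1
  exact ⟨e.injective.countable, fun C hC ⟨f, hf⟩ => hB.2 C hC ⟨_, hf.embedding_comp e⟩⟩

theorem Forb.not_range_subset [L.IsRelational] {F : Set (Str L)} {A B W : Str L} (hA : A ∈ F)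
    {f : A → B} (hf : IsHomEmb f) (hW : W ∈ Forb F) (e : W ↪[L] B) :
    ∃ x, f x ∉ Set.range e := by
  by_contra! h
  obtain ⟨g, hg, -⟩ := hf.exists_factor e h
  exact hW.2 A hA ⟨g, hg⟩

/-- In a family that is closed for homomorphism-embedding images, homomorphism-embeddings may be
replaced by injective ones, with a smaller range. -/
theorem ClosedForHomEmbImages.exists_injective [L.IsRelational] {F : Set (Str L)}
    (hF : ClosedForHomEmbImages F) {A B : Str L} (hA : A ∈ F) {f : A → B} (hf : IsHomEmb f) :
    ∃ A' ∈ F, ∃ g : A' → B, IsHomEmb g ∧ Function.Injective g ∧ Set.range g ⊆ Set.range f := by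
  obtain ⟨f', hf', hff'⟩ := hf.exists_factor (induceEmb B (Set.range f))
    fun x => ⟨⟨f x, x, rfl⟩, rfl⟩
  obtain ⟨A', hA', g, hg, hgi⟩ := hF A hA _ f' hf' (by
    rintro ⟨_, x, rfl⟩
    exact ⟨x, Subtype.ext (hff' x)⟩)
  refine ⟨A', hA', _, hg.embedding_comp (induceEmb B (Set.range f)),
    (induceEmb B (Set.range f)).injective.comp hgi, ?_⟩
  rintro _ ⟨x, rfl⟩
  exact induceEmb_mem _ _ _

/-! ### Connected sets and components -/

/-- A non-empty set of vertices that induces a connected subgraph of the Gaifman graph: it has no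
proper non-empty subset that is closed under adjacency. -/
def ConnectedOn (A : Str L) (C : Set A) : Prop :=
  C.Nonempty ∧ ∀ T ⊆ C, T.Nonempty → (∀ x ∈ T, ∀ y ∈ C, (gaifman A).Adj x y → y ∈ T) → C ⊆ T

/-- Replaces walks in an induced subgraph by closure under adjacency. In this form components can be
moved to another structure after an exchange of pieces. -/
theorem isComponent_iff {A : Str L} {R C : Set A} :
    IsComponent A R C ↔ ConnectedOn A C ∧ Disjoint C R ∧
      ∀ x ∈ C, ∀ y ∉ R, (gaifman A).Adj x y → y ∈ C := by
  constructor
  · rintro ⟨c, rfl⟩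
    refine ⟨⟨c.nonempty_supp.image _, ?_⟩, ?_, ?_⟩
    · rintro T hT ⟨x, hx⟩ hcl _ ⟨y, hy, rfl⟩
      obtain ⟨x, hxc, rfl⟩ := hT hx
      have hr : ((gaifman A).induce Rᶜ).Reachable x y :=
        SimpleGraph.ConnectedComponent.exact (hxc.trans hy.symm)
      obtain ⟨p⟩ := hr
      induction p with
      | nil => exact hx
      | @cons a b d hab p ih =>
        have hb : b ∈ c.supp := by
          rw [SimpleGraph.ConnectedComponent.mem_supp_iff] at hxc ⊢
          rw [← hxc]
          exact SimpleGraph.ConnectedComponent.sound hab.symm.reachable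
        exact ih hy hb (hcl _ hx _ ⟨b, hb, rfl⟩ hab)
    · rw [Set.disjoint_left]
      rintro _ ⟨x, -, rfl⟩
      exact x.2
    · rintro _ ⟨x, hx, rfl⟩ y hy hxy
      refine ⟨⟨y, hy⟩, ?_, rfl⟩
      rw [SimpleGraph.ConnectedComponent.mem_supp_iff] at hx ⊢
      rw [← hx]
      have : ((gaifman A).induce Rᶜ).Adj ⟨y, hy⟩ x := hxy.symm
      exact SimpleGraph.ConnectedComponent.sound this.reachable
  · rintro ⟨⟨⟨x, hx⟩, hC⟩, hCR, hcl⟩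
    have hxR : x ∈ Rᶜ := Set.disjoint_left.1 hCR hx
    refine ⟨((gaifman A).induce Rᶜ).connectedComponentMk ⟨x, hxR⟩, ?_⟩
    apply Set.Subset.antisymm
    · refine (hC (C ∩ Subtype.val ''
        (((gaifman A).induce Rᶜ).connectedComponentMk ⟨x, hxR⟩).supp) Set.inter_subset_left
        ⟨x, hx, ⟨x, hxR⟩, rfl, rfl⟩ ?_).trans Set.inter_subset_right
      rintro _ ⟨-, a, ha, rfl⟩ y hy hay
      have hyR : y ∈ Rᶜ := Set.disjoint_left.1 hCR hy
      refine ⟨hy, ⟨y, hyR⟩, ?_, rfl⟩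
      rw [SimpleGraph.ConnectedComponent.mem_supp_iff] at ha ⊢
      rw [← ha]
      have : ((gaifman A).induce Rᶜ).Adj ⟨y, hyR⟩ a := hay.symm
      exact SimpleGraph.ConnectedComponent.sound this.reachable
    · rintro _ ⟨y, hy, rfl⟩
      have hr : ((gaifman A).induce Rᶜ).Reachable ⟨x, hxR⟩ y :=
        SimpleGraph.ConnectedComponent.exact (Eq.symm hy)
      obtain ⟨p⟩ := hr
      clear hy
      have key : ∀ a b : ↥(Rᶜ), ((gaifman A).induce Rᶜ).Walk a b → (a : A) ∈ C → (b : A) ∈ C := by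
        intro a b p
        induction p with
        | nil => exact id
        | @cons a b d hab p ih => exact fun ha => ih (hcl _ ha _ b.2 hab)
      exact key _ _ p hx

theorem exists_isComponent {A : Str L} {R : Set A} {x : A} (hx : x ∉ R) :
    ∃ C, IsComponent A R C ∧ x ∈ C :=
  ⟨_, ⟨((gaifman A).induce Rᶜ).connectedComponentMk ⟨x, hx⟩, rfl⟩, ⟨x, hx⟩, rfl, rfl⟩

/-- A connected set that is disjoint from `R` and meets a component lies in it. -/
theorem ConnectedOn.subset_of_isComponent {A : Str L} {R C D : Set A} (hD : ConnectedOn A D)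
    (hDR : Disjoint D R) (hC : IsComponent A R C) {x : A} (hxD : x ∈ D) (hxC : x ∈ C) :
    D ⊆ C := by
  obtain ⟨-, -, hcl⟩ := isComponent_iff.1 hC
  exact (hD.2 (D ∩ C) Set.inter_subset_left ⟨x, hxD, hxC⟩ fun a ha y hy hay =>
    ⟨hy, hcl a ha.2 y (Set.disjoint_left.1 hDR hy) hay⟩).trans Set.inter_subset_right

theorem IsComponent.eq_of_mem {A : Str L} {R C D : Set A} (hC : IsComponent A R C)
    (hD : IsComponent A R D) {x : A} (hxC : x ∈ C) (hxD : x ∈ D) : C = D := by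
  obtain ⟨hC', hCR, -⟩ := isComponent_iff.1 hC
  obtain ⟨hD', hDR, -⟩ := isComponent_iff.1 hD
  exact (hC'.subset_of_isComponent hCR hD hxC hxD).antisymm
    (hD'.subset_of_isComponent hDR hC hxD hxC)

theorem IsComponent.neighbourhood_subset {A : Str L} {R C : Set A} (hC : IsComponent A R C) :
    neighbourhood A C ⊆ R := by
  rintro x ⟨hx, y, hy, hxy⟩
  by_contra hxR
  exact hx ((isComponent_iff.1 hC).2.2 y hy x hxR hxy.symm)

theorem ConnectedOn.isComponent_neighbourhood {A : Str L} {C : Set A} (hC : ConnectedOn A C) :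
    IsComponent A (neighbourhood A C) C := by
  refine isComponent_iff.2 ⟨hC, Set.disjoint_left.2 fun x hx h => h.1 hx, fun x hx y hy hxy => ?_⟩
  by_contra h
  exact hy ⟨h, x, hx, hxy.symm⟩

/-- Removing the neighbourhood of a connected set, every other component has a neighbourhood that
is a minimal separating cut. -/
theorem isMinimalSeparating_neighbourhood {A : Str L} {C₀ C : Set A} (hC₀ : ConnectedOn A C₀)
    (hC : IsComponent A (neighbourhood A C₀) C) (hne : C ≠ C₀) :
    IsMinimalSeparating A (neighbourhood A C) C := by
  have hdisj : ∀ x ∈ C₀, x ∉ C := fun x hx hx' =>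
    hne (hC.eq_of_mem hC₀.isComponent_neighbourhood hx' hx)
  obtain ⟨hCc, hCd, hcl⟩ := isComponent_iff.1 hC
  have hsub := hC.neighbourhood_subset
  obtain ⟨x, hx⟩ := hC₀.1
  have hC₀d : Disjoint C₀ (neighbourhood A C) := Set.disjoint_left.2 fun y hy hy' => (hsub hy').1 hy
  -- The second component required by the cut is the one around `C₀`: `N(C) ⊆ N(C₀)`, so `C₀` avoids
  -- `N(C)` and every vertex of `N(C)` has a neighbour in `C₀`.
  obtain ⟨C', hC', hxC'⟩ := exists_isComponent (A := A) (R := neighbourhood A C)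
    (x := x) (Set.disjoint_left.1 hC₀d hx)
  have hC₀C' := hC₀.subset_of_isComponent hC₀d hC' hx hxC'
  refine ⟨hCc.isComponent_neighbourhood, rfl, C', hC', ?_, ?_⟩
  · rintro rfl
    exact hdisj x hx hxC'
  · refine hC'.neighbourhood_subset.antisymm fun r hr => ?_
    obtain ⟨-, y, hy, hry⟩ := hsub hr
    exact ⟨Set.disjoint_right.1 (isComponent_iff.1 hC').2.1 hr, y, hC₀C' hy, hry⟩

/-! ### Free amalgamations -/

/-- The vertices are those of `B₁` and those of `B₂` outside the copy of `A`; `j` places `B₂` among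
them, and the tuples are exactly the images of tuples of one part. -/
theorem exists_isFreeAmalgam [L.IsRelational] {A B₁ B₂ : Str L} (α₁ : A ↪[L] B₁)
    (α₂ : A ↪[L] B₂) :
    ∃ (D : Str L) (β₁ : B₁ ↪[L] D) (β₂ : B₂ ↪[L] D), IsFreeAmalgam D α₁ α₂ β₁ β₂ := by
  classical
  let j : B₂ → B₁ ⊕ {w : B₂ // w ∉ Set.range α₂} := fun w =>
    if h : w ∈ Set.range α₂ then Sum.inl (α₁ h.choose) else Sum.inr ⟨w, h⟩
  have j_in : ∀ a, j (α₂ a) = Sum.inl (α₁ a) := fun a => by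
    have h : α₂ a ∈ Set.range α₂ := ⟨a, rfl⟩
    simp only [j, dif_pos h]
    rw [α₂.injective h.choose_spec]
  have j_out : ∀ w (h : w ∉ Set.range α₂), j w = Sum.inr ⟨w, h⟩ := fun w h => by
    simp only [j, dif_neg h]
  have j_inl : ∀ w b, j w = Sum.inl b → ∃ a, α₂ a = w ∧ α₁ a = b := fun w b h => by
    by_cases hw : w ∈ Set.range α₂
    · obtain ⟨a, rfl⟩ := hw
      rw [j_in] at h
      exact ⟨a, rfl, Sum.inl.inj h⟩
    · rw [j_out w hw] at h
      cases h
  have j_inj : Function.Injective j := fun w w' h => by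
    by_cases hw : w ∈ Set.range α₂
    · obtain ⟨a, rfl⟩ := hw
      rw [j_in] at h
      obtain ⟨a', rfl, ha'⟩ := j_inl _ _ h.symm
      rw [α₁.injective ha']
    · rw [j_out w hw] at h
      by_cases hw' : w' ∈ Set.range α₂
      · obtain ⟨a, rfl⟩ := hw'
        rw [j_in] at h
        cases h
      · rw [j_out w' hw'] at h
        simpa using h
  let st : L.Structure (B₁ ⊕ {w : B₂ // w ∉ Set.range α₂}) :=
    { funMap := fun g => isEmptyElim g
      RelMap := fun {n} R t => (∃ s : Fin n → B₁, Sum.inl ∘ s = t ∧ RelMap R s) ∨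
        ∃ s : Fin n → B₂, j ∘ s = t ∧ RelMap R s }
  let β₁ : B₁ ↪[L] (B₁ ⊕ {w : B₂ // w ∉ Set.range α₂}) := mkEmb Sum.inl
    Sum.inl_injective fun n R t => by
      constructor
      · rintro (⟨s, hs, h⟩ | ⟨s, hs, h⟩)
        · rwa [← Sum.inl_injective.comp_left hs]
        · choose a ha ha' using fun i => j_inl (s i) (t i) (congrFun hs i)
          rw [← funext ha] at h
          rw [← funext ha']
          exact (α₁.map_rel R a).2 ((α₂.map_rel R a).1 h)
      · exact fun h => Or.inl ⟨t, rfl, h⟩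
  let β₂ : B₂ ↪[L] (B₁ ⊕ {w : B₂ // w ∉ Set.range α₂}) := mkEmb j j_inj fun n R t => by
      constructor
      · rintro (⟨s, hs, h⟩ | ⟨s, hs, h⟩)
        · choose a ha ha' using fun i => j_inl (t i) (s i) (congrFun hs i).symm
          rw [← funext ha'] at h
          rw [← funext ha]
          exact (α₂.map_rel R a).2 ((α₁.map_rel R a).1 h)
        · rwa [← j_inj.comp_left hs]
      · exact fun h => Or.inr ⟨t, rfl, h⟩
  refine ⟨⟨_, st⟩, β₁, β₂, ⟨fun a => (j_in a).symm, fun x₁ x₂ h => ?_⟩, ?_, ?_⟩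
  · obtain ⟨a, h₁, h₂⟩ := j_inl x₂ x₁ h.symm
    exact ⟨a, h₂, h₁⟩
  · rintro (b | ⟨w, hw⟩)
    · exact Or.inl ⟨b, rfl⟩
    · exact Or.inr ⟨w, j_out w hw⟩
  · rintro n R t (⟨s, rfl, -⟩ | ⟨s, rfl, -⟩) ⟨i, k, ⟨x, hx, hxi⟩, y, hy, hyk⟩
    · obtain ⟨a, rfl, -⟩ := j_inl y (s k) hyk
      exact hy ⟨a, rfl⟩
    · obtain ⟨a, -, rfl⟩ := j_inl (s i) x hxi.symm
      exact hx ⟨a, rfl⟩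

section FreeAmalgam

variable {X : Type*} {B₁ B₂ C : Str L} {α₁ : X → B₁} {α₂ : X → B₂} {β₁ : B₁ → C} {β₂ : B₂ → C}

theorem IsFreeAmalgam.symm (h : IsFreeAmalgam C α₁ α₂ β₁ β₂) : IsFreeAmalgam C α₂ α₁ β₂ β₁ :=
  ⟨⟨fun a => (h.1.1 a).symm, fun x₁ x₂ hx => by
      obtain ⟨a, h₁, h₂⟩ := h.1.2 x₂ x₁ hx.symm
      exact ⟨a, h₂, h₁⟩⟩, fun c => (h.2.1 c).symm,
    fun n R t ht ⟨i, j, hi, hj⟩ => h.2.2 n R t ht ⟨j, i, hj, hi⟩⟩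

theorem IsFreeAmalgam.countable (h : IsFreeAmalgam C α₁ α₂ β₁ β₂) [Countable B₁]
    [Countable B₂] : Countable C := by
  have : Function.Surjective (Sum.elim β₁ β₂) := fun c => by
    rcases h.2.1 c with ⟨b, rfl⟩ | ⟨b, rfl⟩
    exacts [⟨Sum.inl b, rfl⟩, ⟨Sum.inr b, rfl⟩]
  exact this.countable

theorem IsFreeAmalgam.mem_image_compl (h : IsFreeAmalgam C α₁ α₂ β₁ β₂) {c : C}
    (hc : c ∉ Set.range β₂) : c ∈ β₁ '' (Set.range α₁)ᶜ := by
  obtain ⟨b, rfl⟩ := (h.2.1 c).resolve_right hc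
  refine ⟨b, ?_, rfl⟩
  rintro ⟨a, rfl⟩
  exact hc ⟨α₂ a, (h.1.1 a).symm⟩

theorem IsFreeAmalgam.range_or_range (h : IsFreeAmalgam C α₁ α₂ β₁ β₂) {n : ℕ}
    {R : L.Relations n} {t : Fin n → C} (ht : RelMap R t) :
    (∀ i, t i ∈ Set.range β₁) ∨ ∀ i, t i ∈ Set.range β₂ := by
  by_contra! hcon
  obtain ⟨⟨i, hi⟩, j, hj⟩ := hcon
  exact h.2.2 n R t ht ⟨j, i, h.mem_image_compl hj, h.symm.mem_image_compl hi⟩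

end FreeAmalgam

/-- The local half of gluing: an irreducible set inside one part remains irreducible when pulled
back to that part, so the conditions on `g` there are those on `f`. -/
theorem IsHomEmb.injOn_and_reflect_of_subset_range {A B D : Str L} (e : A ↪[L] B) {g : B → D}
    {f : A → D} (hf : IsHomEmb f) (hg : ∀ x, g (e x) = f x) {S : Set B} (hS : IsIrreducibleOn B S)
    (hSe : S ⊆ Set.range e) : Set.InjOn g S ∧
      ∀ (n : ℕ) (R : L.Relations n) (t : Fin n → B), (∀ i, t i ∈ S) → RelMap R (g ∘ t) →
        RelMap R t := by
  have hS' : IsIrreducibleOn A (e ⁻¹' S) := by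
    intro x hx y hy hxy
    obtain ⟨n, R, t, ht, htS, ⟨i, hi⟩, ⟨j, hj⟩⟩ := hS _ hx _ hy (e.injective.ne hxy)
    choose s hs using fun i => hSe (htS i)
    obtain rfl : e ∘ s = t := funext hs
    exact ⟨n, R, s, (e.map_rel R s).1 ht, htS, ⟨i, e.injective hi⟩, ⟨j, e.injective hj⟩⟩
  constructor
  · intro x hx y hy hxy
    obtain ⟨x, rfl⟩ := hSe hx
    obtain ⟨y, rfl⟩ := hSe hy
    rw [hg, hg] at hxy
    rw [hf.injOn _ hS' hx hy hxy]
  · intro n R t htS ht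
    choose s hs using fun i => hSe (htS i)
    obtain rfl : e ∘ s = t := funext hs
    refine (e.map_rel R s).2 (hf.reflect_rel _ hS' n R s htS ?_)
    rwa [← Function.comp_assoc, show g ∘ e = f from funext hg] at ht

/-- Homomorphism-embeddings of the two parts of a free amalgamation can be glued. -/
theorem IsFreeAmalgam.exists_glue {X : Type*} {B₁ B₂ C D : Str L} {α₁ : X → B₁} {α₂ : X → B₂}
    {e₁ : B₁ ↪[L] C} {e₂ : B₂ ↪[L] C} (h : IsFreeAmalgam C α₁ α₂ e₁ e₂) {f₁ : B₁ → D}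
    {f₂ : B₂ → D} (hf₁ : IsHomEmb f₁) (hf₂ : IsHomEmb f₂) (hf : ∀ a, f₁ (α₁ a) = f₂ (α₂ a)) :
    ∃ g : C → D, IsHomEmb g ∧ (∀ x, g (e₁ x) = f₁ x) ∧ ∀ x, g (e₂ x) = f₂ x := by
  classical
  have hex : ∀ c, ∃ d, (∀ x, e₁ x = c → f₁ x = d) ∧ ∀ x, e₂ x = c → f₂ x = d := fun c => by
    rcases h.2.1 c with ⟨b, rfl⟩ | ⟨b, rfl⟩
    · refine ⟨f₁ b, fun x hx => by rw [e₁.injective hx], fun x hx => ?_⟩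
      obtain ⟨a, rfl, rfl⟩ := h.1.2 b x hx.symm
      exact (hf a).symm
    · refine ⟨f₂ b, fun x hx => ?_, fun x hx => by rw [e₂.injective hx]⟩
      obtain ⟨a, rfl, rfl⟩ := h.1.2 x b hx
      exact hf a
  choose g hg using hex
  have hg₁ : ∀ x, g (e₁ x) = f₁ x := fun x => ((hg _).1 x rfl).symm
  have hg₂ : ∀ x, g (e₂ x) = f₂ x := fun x => ((hg _).2 x rfl).symm
  have hS : ∀ S : Set C, IsIrreducibleOn C S → Set.InjOn g S ∧
      ∀ (n : ℕ) (R : L.Relations n) (t : Fin n → C), (∀ i, t i ∈ S) → RelMap R (g ∘ t) →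
        RelMap R t := fun S hS => by
    -- An irreducible set lies in one part: a vertex outside the first part shares a tuple with each
    -- other vertex of the set, and that tuple must lie in the second part.
    by_cases h₁ : S ⊆ Set.range e₁
    · exact hf₁.injOn_and_reflect_of_subset_range e₁ hg₁ hS h₁
    · refine hf₂.injOn_and_reflect_of_subset_range e₂ hg₂ hS ?_
      obtain ⟨x, hxS, hx⟩ := Set.not_subset.1 h₁
      have hx' := (h.2.1 x).resolve_left hx
      intro y hy
      by_contra hy'
      obtain ⟨n, R, t, ht, -, ⟨i, hi⟩, ⟨j, hj⟩⟩ := hS x hxS y hy fun hxy => hy' (hxy ▸ hx')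
      rcases h.range_or_range ht with ht | ht
      · exact hx (hi ▸ ht i)
      · exact hy' (hj ▸ ht j)
  refine ⟨g, ⟨fun n R t ht => ?_, fun S h => (hS S h).1, fun S h => (hS S h).2⟩, hg₁, hg₂⟩
  rcases h.range_or_range ht with ht' | ht'
  · choose s hs using ht'
    obtain rfl : e₁ ∘ s = t := funext hs
    rw [← Function.comp_assoc, show g ∘ e₁ = f₁ from funext hg₁]
    exact hf₁.map_rel n R s ((e₁.map_rel R s).1 ht)
  · choose s hs using ht'
    obtain rfl : e₂ ∘ s = t := funext hs
    rw [← Function.comp_assoc, show g ∘ e₂ = f₂ from funext hg₂]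
    exact hf₂.map_rel n R s ((e₂.map_rel R s).1 ht)

/-! ### Exchanging pieces -/

/-- Removing the component of a minimal separating cut yields a piece, whose class `c` is found in
every substructure that contains its image, and which can be exchanged for any piece of the same
class. -/
theorem exists_exchange [L.IsRelational] {F : Set (Str L)} {A D : Str L} (hA : A ∈ F)
    (hfin : Finite A) (hconn : IsConnectedStr A) {R C : Set A} (hRC : IsMinimalSeparating A R C)
    {f : A → D} (hf : IsHomEmb f) (hinj : Set.InjOn f R) :
    ∃ (n : ℕ) (c : PieceClass F n) (t : Fin n → D), (∀ i, t i ∈ f '' R) ∧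
      (∀ (W : Str L) (e : W ↪[L] D), (∀ x ∈ C ∪ R, f x ∈ Set.range e) →
        ∃ s, e ∘ s = t ∧ InCanonicalLift F W c s) ∧
      ∀ (W : Str L) (e : W ↪[L] D) (s : Fin n → W), e ∘ s = t → InCanonicalLift F W c s →
        ∃ A' ∈ F, ∃ (ι : induce A Cᶜ ↪[L] A') (g : A' → D), IsHomEmb g ∧
          (∀ x, g (ι x) = f (induceEmb A Cᶜ x)) ∧ (∀ y, y ∉ Set.range ι → g y ∈ Set.range e) ∧
          (∀ x, induceEmb A Cᶜ x ∉ R → ∀ y, (gaifman A').Adj (ι x) y → y ∈ Set.range ι) ∧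
          ∀ x y, induceEmb A Cᶜ x ∉ R → ((gaifman A').Adj (ι x) (ι y) ↔
            (gaifman A).Adj (induceEmb A Cᶜ x) (induceEmb A Cᶜ y)) := by
  obtain ⟨hCc, hCR, hcl⟩ := isComponent_iff.1 hRC.1
  let r : Fin (Nat.card R) ≃ R := (Finite.equivFin R).symm
  let P : Rooted L (Nat.card R) := ⟨induce A (C ∪ R),
    ⟨fun i => (⟨r i, Or.inr (r i).2⟩ : ↥(C ∪ R)), fun i j h =>
      r.injective (Subtype.ext (congrArg (fun x : ↥(C ∪ R) => (x : A)) h))⟩⟩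
  let Q : Rooted L (Nat.card R) := ⟨induce A Cᶜ,
    ⟨fun i => (⟨r i, Set.disjoint_right.1 hCR (r i).2⟩ : ↥(Cᶜ)), fun i j h =>
      r.injective (Subtype.ext (congrArg (fun x : ↥(Cᶜ) => (x : A)) h))⟩⟩
  have hrange : Set.range (fun i => (r i : A)) = R := by
    ext x
    exact ⟨fun ⟨i, hi⟩ => hi ▸ (r i).2, fun hx => ⟨r.symm ⟨x, hx⟩,
      congrArg Subtype.val (r.apply_symm_apply ⟨x, hx⟩)⟩⟩
  have hP : ∃ A ∈ F, IsPiece P A :=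
    ⟨A, hA, hconn, R, C, induceEmb A (C ∪ R), hRC, range_induceEmb A _, hrange⟩
  have htuple : ∀ (n : ℕ) (S : L.Relations n) (t : Fin n → A), RelMap S t → ∀ i, t i ∉ C →
      t i ∉ R → ∀ j, t j ∉ C := fun n S t ht i hi hi' j hj =>
    hi (hcl _ hj _ hi' ⟨fun h => hi (h ▸ hj), n, S, t, ht, ⟨j, rfl⟩, ⟨i, rfl⟩⟩)
  -- No tuple meets both `C` and the complement of `C ∪ R`, so `A` is the free amalgamation of the
  -- piece and of the rest along `R`.
  have hPQ : IsRootedSum P Q A := by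
    refine ⟨induceEmb A (C ∪ R), induceEmb A Cᶜ, ⟨fun _ => rfl, ?_⟩, ?_, ?_⟩
    · rintro ⟨x, hx⟩ ⟨y, hy⟩ (rfl : x = y)
      obtain ⟨i, rfl⟩ := hrange.symm.subset (hx.resolve_left hy)
      exact ⟨i, rfl, rfl⟩
    · intro x
      by_cases hx : x ∈ C
      · exact Or.inl ⟨(⟨x, Or.inl hx⟩ : ↥(C ∪ R)), rfl⟩
      · exact Or.inr ⟨(⟨x, hx⟩ : ↥(Cᶜ)), rfl⟩
    · rintro n S t ht ⟨i, j, ⟨⟨x, hx⟩, hx', hxi⟩, ⟨y, hy⟩, hy', hyj⟩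
      replace hxi : x = t i := hxi
      replace hyj : y = t j := hyj
      subst hxi hyj
      refine htuple n S t ht j hy (fun h => hy' ?_) i (hx.resolve_right fun h => hx' ?_)
      · obtain ⟨k, hk⟩ := hrange.symm.subset h
        exact ⟨k, Subtype.ext hk⟩
      · obtain ⟨k, hk⟩ := hrange.symm.subset h
        exact ⟨k, Subtype.ext hk⟩
  refine ⟨Nat.card R, Quotient.mk (pieceSetoid F _) ⟨P, hP⟩, fun i => f (r i),
    fun i => ⟨r i, (r i).2, rfl⟩, ?_, ?_⟩
  · intro W e he
    obtain ⟨h, hh, heh⟩ := (hf.comp_embedding (induceEmb A (C ∪ R))).exists_factor e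
      fun x => he _ x.2
    refine ⟨h ∘ P.root, funext fun i => heh _, ⟨P, hP⟩, rfl, h, hh, rfl, fun i j hij => ?_⟩
    have := congrArg e hij
    simp only [Function.comp_apply] at this
    rw [heh, heh] at this
    exact r.injective (Subtype.ext (hinj (r i).2 (r j).2 this))
  · rintro W e s hs ⟨P', hP', f', hf', hfs, -⟩
    have hinc : incompatible F P'.1 = incompatible F P := Quotient.exact hP'
    -- The exchange: `Q` is incompatible with `P`, hence with the equivalent piece `P'`, so `P' ⊕ Q`
    -- is again a member of `F`.
    obtain ⟨A', hA', e₁, e₂, hfree⟩ : Q ∈ incompatible F P'.1 := hinc ▸ ⟨A, hA, hPQ⟩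
    obtain ⟨g, hg, hg₁, hg₂⟩ := hfree.exists_glue (hf'.embedding_comp e)
      (hf.comp_embedding (induceEmb A Cᶜ)) fun i => by
        rw [show f' (P'.1.root i) = s i from congrFun hfs i]
        exact congrFun hs i
    -- Tuples of `A'` through a non-root vertex of `Q` stay inside `Q`; hence adjacency at such
    -- vertices is the same as in `A`.
    have hclosed : ∀ (n : ℕ) (S : L.Relations n) (t : Fin n → A'), RelMap S t →
        ∀ x, induceEmb A Cᶜ x ∉ R → e₂ x ∈ Set.range t → ∀ j, t j ∈ Set.range e₂ := by
      rintro n S t ht x hx ⟨i, hi⟩ j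
      by_contra hj
      refine hfree.2.2 n S t ht ⟨j, i, hfree.mem_image_compl hj, x, ?_, hi.symm⟩
      rintro ⟨k, rfl⟩
      exact hx (r k).2
    refine ⟨A', hA', e₂, g, hg, hg₂, fun y hy => ?_, ?_, ?_⟩
    · obtain ⟨x, rfl⟩ := (hfree.2.1 y).resolve_right hy
      exact ⟨f' x, (hg₁ x).symm⟩
    · rintro x hx y ⟨-, n, S, t, ht, hxt, j, rfl⟩
      exact hclosed n S t ht x hx hxt j
    · intro x y hx
      constructor
      · rintro ⟨hne, n, S, t, ht, ⟨i, hi⟩, ⟨j, hj⟩⟩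
        choose s hs using hclosed n S t ht x hx ⟨i, hi⟩
        obtain rfl : e₂ ∘ s = t := funext hs
        obtain rfl : s i = x := e₂.injective hi
        obtain rfl : s j = y := e₂.injective hj
        exact ⟨fun h => hne (congrArg e₂ ((induceEmb A Cᶜ).injective h)), n, S, _,
          ((induceEmb A Cᶜ).map_rel S s).2 ((e₂.map_rel S s).1 ht), ⟨i, rfl⟩, ⟨j, rfl⟩⟩
      · rintro ⟨hne, n, S, t, ht, ⟨i, hi⟩, ⟨j, hj⟩⟩
        have htC := htuple n S t ht i (hi ▸ x.2) (hi ▸ hx)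
        let s : Fin n → induce A Cᶜ := fun k => (⟨t k, htC k⟩ : ↥(Cᶜ))
        have hs : induceEmb A Cᶜ ∘ s = t := rfl
        refine ⟨fun h => hne (congrArg _ (e₂.injective h)), n, S, e₂ ∘ s,
          (e₂.map_rel S s).2 (((induceEmb A Cᶜ).map_rel S s).1 ht), ⟨i, ?_⟩, ⟨j, ?_⟩⟩
        · exact congrArg e₂ (Subtype.ext hi)
        · exact congrArg e₂ (Subtype.ext hj)

/-! ### Free amalgamations of structures in `Forb(F)` -/

section Transport

variable [L.IsRelational] {A A' : Str L} {C R : Set A} (ι : induce A Cᶜ ↪[L] A')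
  (hι : ∀ x, induceEmb A Cᶜ x ∉ R → ∀ y, (gaifman A').Adj (ι x) y → y ∈ Set.range ι)
  (hadj : ∀ x y, induceEmb A Cᶜ x ∉ R → ((gaifman A').Adj (ι x) (ι y) ↔
    (gaifman A).Adj (induceEmb A Cᶜ x) (induceEmb A Cᶜ y)))
  {S : Set A}

include hadj in
-- An exchange changes `A` only on the removed component `C` and around its cut `R`, so sets away
-- from both keep their adjacencies.
theorem ConnectedOn.transport (hSC : Disjoint S C) (hSR : Disjoint S R) (hS : ConnectedOn A S) :
    ConnectedOn A' (ι '' (induceEmb A Cᶜ ⁻¹' S)) := by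
  have hmem : ∀ x ∈ S, ∃ y, induceEmb A Cᶜ y = x := fun x hx =>
    ⟨(⟨x, Set.disjoint_left.1 hSC hx⟩ : ↥(Cᶜ)), rfl⟩
  constructor
  · obtain ⟨x, hx⟩ := hS.1
    obtain ⟨y, rfl⟩ := hmem x hx
    exact ⟨_, y, hx, rfl⟩
  · rintro T hT ⟨_, ht⟩ hcl
    obtain ⟨x, hx, rfl⟩ := hT ht
    have := hS.2 (induceEmb A Cᶜ '' (ι ⁻¹' T)) (by
      rintro _ ⟨y, hy, rfl⟩
      obtain ⟨z, hz, hzy⟩ := hT hy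
      rwa [← ι.injective hzy]) ⟨_, x, ht, rfl⟩ (by
      rintro _ ⟨y, hy, rfl⟩ b hb hyb
      obtain ⟨b, rfl⟩ := hmem b hb
      refine ⟨b, hcl _ hy _ ⟨b, hb, rfl⟩ ((hadj y b ?_).2 hyb), rfl⟩
      obtain ⟨z, hz, hzy⟩ := hT hy
      rw [← ι.injective hzy]
      exact Set.disjoint_left.1 hSR hz)
    rintro _ ⟨y, hy, rfl⟩
    obtain ⟨z, hz, hzy⟩ := this hy
    rwa [← (induceEmb A Cᶜ).injective hzy]

include hι hadj in
theorem neighbourhood_transport (hSC : Disjoint S C) (hSR : Disjoint S R) :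
    neighbourhood A' (ι '' (induceEmb A Cᶜ ⁻¹' S)) =
      ι '' (induceEmb A Cᶜ ⁻¹' neighbourhood A S) := by
  ext y
  constructor
  · rintro ⟨hy, _, ⟨x, hx, rfl⟩, hxy⟩
    have hxR := Set.disjoint_left.1 hSR hx
    obtain ⟨y, rfl⟩ := hι x hxR _ hxy.symm
    exact ⟨y, ⟨fun h => hy ⟨y, h, rfl⟩, _, hx, ((hadj x y hxR).1 hxy.symm).symm⟩, rfl⟩
  · rintro ⟨y, ⟨hy, x, hx, hxy⟩, rfl⟩
    refine ⟨?_, ?_⟩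
    · rintro ⟨z, hz, hzy⟩
      rw [ι.injective hzy] at hz
      exact hy hz
    · let x' : induce A Cᶜ := (⟨x, Set.disjoint_left.1 hSC hx⟩ : ↥(Cᶜ))
      exact ⟨ι x', ⟨x', hx, rfl⟩, ((hadj x' y (Set.disjoint_left.1 hSR hx)).2 hxy.symm).symm⟩

end Transport

section Core

variable [L.IsRelational] {F : Set (Str L)} (hF : ∀ A ∈ F, Finite A ∧ IsConnectedStr A)
  {X : Type*} {W₁ W₂ D : Str L} {α₁ : X → W₁} {α₂ : X → W₂} {β₁ : W₁ ↪[L] D} {β₂ : W₂ ↪[L] D}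
  (hagree : ∀ (n : ℕ) (c : PieceClass F n) (t : Fin n → X),
    InCanonicalLift F W₁ c (α₁ ∘ t) → InCanonicalLift F W₂ c (α₂ ∘ t))

include hF hagree

/-- If all the components around a connected set that is mapped to the second part of a strong
amalgamation can be mapped to the second part by exchanging pieces, then there is a member of `F`
that is mapped to the second part. -/
theorem IsStrongAmalgam.false_of_components (h : IsStrongAmalgam α₁ α₂ β₁ β₂) (hW₂ : W₂ ∈ Forb F) :
    ∀ (m : ℕ) (A : Str L), A ∈ F → ∀ (f : A → D), IsHomEmb f → ∀ C₀ : Set A, ConnectedOn A C₀ →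
      (∀ x ∈ C₀, f x ∈ Set.range β₂) → Set.InjOn f (neighbourhood A C₀) →
      (∀ x ∈ neighbourhood A C₀, ∃ a, β₁ (α₁ a) = f x) →
      (∀ x, f x ∉ Set.range β₂ → ∃ C, IsComponent A (neighbourhood A C₀) C ∧ x ∈ C ∧
        ∀ y ∈ C, f y ∈ Set.range β₁) →
      {x | f x ∉ Set.range β₂}.ncard = m → False := by
  intro m
  induction m using Nat.strong_induction_on with
  | _ m ih =>
  intro A hA f hf C₀ hC₀ hfC₀ hinj hN hcomp hm
  obtain ⟨hfin, hconn⟩ := hF A hA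
  obtain ⟨x, hx⟩ := Forb.not_range_subset hA hf hW₂ β₂
  obtain ⟨C, hC, hxC, hfC⟩ := hcomp x hx
  have hne : C ≠ C₀ := by
    rintro rfl
    exact hx (hfC₀ x hxC)
  have hRN := hC.neighbourhood_subset
  -- The piece on `C` is mapped into `W₁` with its root in the common part. Its class is thus
  -- recorded in the lift of `W₁`, by `hagree` in that of `W₂`, and an equivalent piece inside `W₂`
  -- can replace it.
  obtain ⟨n, c, t, ht, h₁, h₂⟩ := exists_exchange hA hfin hconn
    (isMinimalSeparating_neighbourhood hC₀ hC hne) hf (hinj.mono hRN)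
  obtain ⟨s, hs, hcs⟩ := h₁ W₁ β₁ (by
    rintro y (hy | hy)
    · exact hfC y hy
    · obtain ⟨a, ha⟩ := hN y (hRN hy)
      exact ⟨_, ha⟩)
  have hta : ∀ i, ∃ a, β₁ (α₁ a) = t i := fun i => by
    obtain ⟨y, hy, hyt⟩ := ht i
    exact hyt ▸ hN y (hRN hy)
  choose a ha using hta
  obtain rfl : s = α₁ ∘ a := funext fun i => β₁.injective ((congrFun hs i).trans (ha i).symm)
  obtain ⟨A', hA', ι, g, hg, hgι, hgr, hι, hadj⟩ := h₂ W₂ β₂ (α₂ ∘ a)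
    (funext fun i => (h.1 (a i)).symm.trans (ha i)) (hagree n c a hcs)
  obtain ⟨hCc, hCN, -⟩ := isComponent_iff.1 hC
  have hC₀C : Disjoint C₀ C := Set.disjoint_left.2 fun y hy hy' =>
    hne (hC.eq_of_mem hC₀.isComponent_neighbourhood hy' hy)
  have hC₀N : Disjoint C₀ (neighbourhood A C) := Set.disjoint_left.2 fun y hy hy' =>
    (hRN hy').1 hy
  have hN' := neighbourhood_transport ι hι hadj hC₀C hC₀N
  -- The new vertices are mapped to `W₂`, so the vertices mapped outside `W₂` are old and avoid `C`.
  -- As `x ∈ C` was one of them, their number drops.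
  have hcount : {y | g y ∉ Set.range β₂} ⊆ ι '' {q | f (induceEmb A Cᶜ q) ∉ Set.range β₂} := by
    intro y hy
    have : y ∈ Set.range ι := by
      by_contra hy'
      exact hy (hgr y hy')
    obtain ⟨q, rfl⟩ := this
    refine ⟨q, ?_, rfl⟩
    rwa [Set.mem_ofPred_eq, hgι] at hy
  refine ih _ ?_ A' hA' g hg (ι '' (induceEmb A Cᶜ ⁻¹' C₀)) (hC₀.transport ι hadj hC₀C hC₀N)
    ?_ ?_ ?_ ?_ rfl
  · rw [← hm]
    have : Finite (induce A Cᶜ) := Finite.of_injective _ (induceEmb A Cᶜ).injective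
    calc {y | g y ∉ Set.range β₂}.ncard
        ≤ (ι '' {q | f (induceEmb A Cᶜ q) ∉ Set.range β₂}).ncard :=
          Set.ncard_le_ncard hcount (Set.toFinite _)
      _ = (induceEmb A Cᶜ '' {q | f (induceEmb A Cᶜ q) ∉ Set.range β₂}).ncard := by
          rw [Set.ncard_image_of_injective _ ι.injective,
            Set.ncard_image_of_injective _ (induceEmb A Cᶜ).injective]
      _ < {x | f x ∉ Set.range β₂}.ncard := by
          refine Set.ncard_lt_ncard ⟨?_, fun hsub => ?_⟩ (Set.toFinite _)
          · rintro _ ⟨q, hq, rfl⟩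
            exact hq
          · obtain ⟨q, -, hq⟩ := hsub hx
            exact induceEmb_mem A Cᶜ q (hq ▸ hxC)
  · rintro _ ⟨y, hy, rfl⟩
    rw [hgι]
    exact hfC₀ _ hy
  · rw [hN']
    rintro _ ⟨y, hy, rfl⟩ _ ⟨z, hz, rfl⟩ hyz
    rw [hgι, hgι] at hyz
    rw [(induceEmb A Cᶜ).injective (hinj hy hz hyz)]
  · rw [hN']
    rintro _ ⟨y, hy, rfl⟩
    rw [hgι]
    exact hN _ hy
  -- The other components around `C₀` are disjoint from `C` and from its cut; they survive as
  -- components around the copy of `C₀`.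
  · intro y hy
    obtain ⟨q, hq, rfl⟩ := hcount hy
    obtain ⟨E, hE, hqE, hfE⟩ := hcomp _ hq
    obtain ⟨hEc, hEN, -⟩ := isComponent_iff.1 hE
    have hEC : Disjoint E C := Set.disjoint_left.2 fun z hz hz' => by
      rw [hE.eq_of_mem hC hz hz'] at hqE
      exact induceEmb_mem A Cᶜ q hqE
    have hER := hEN.mono_right hRN
    refine ⟨ι '' (induceEmb A Cᶜ ⁻¹' E), isComponent_iff.2
      ⟨hEc.transport ι hadj hEC hER, ?_, ?_⟩, ⟨q, hqE, rfl⟩, ?_⟩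
    · rw [hN', Set.disjoint_left]
      rintro _ ⟨z, hz, rfl⟩ ⟨w, hw, hwz⟩
      rw [ι.injective hwz] at hw
      exact Set.disjoint_left.1 hEN hz hw
    · intro z hz w hw hzw
      by_contra hwE
      have : w ∈ neighbourhood A' (ι '' (induceEmb A Cᶜ ⁻¹' E)) := ⟨hwE, z, hz, hzw.symm⟩
      rw [neighbourhood_transport ι hι hadj hEC hER] at this
      rw [hN'] at hw
      exact hw (Set.image_mono (Set.preimage_mono hE.neighbourhood_subset) this)
    · rintro _ ⟨z, hz, rfl⟩
      rw [hgι]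
      exact hfE _ hz

/-- The free amalgamation of two structures of `Forb(F)` belongs to `Forb(F)`, if their canonical
lifts agree on the common part, where one of them is maximal. -/
theorem IsFreeAmalgam.mem_Forb (hclosed : ClosedForHomEmbImages F)
    (h : IsFreeAmalgam D α₁ α₂ β₁ β₂) (hW₁ : W₁ ∈ Forb F) (hW₂ : W₂ ∈ Forb F)
    (hmax : IsMaximalOn F W₁ (Set.range α₁)) : D ∈ Forb F := by
  -- Induction on the number of image vertices outside `W₁`. Images are counted, rather than
  -- vertices of `A`, because exchanges may destroy injectivity and may enlarge the member of `F`.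
  have key : ∀ (k : ℕ) (A : Str L), A ∈ F → ∀ f : A → D, IsHomEmb f →
      (Set.range f \ Set.range β₁).ncard < k → False := by
    intro k
    induction k with
    | zero => exact fun _ _ _ _ h => absurd h (Nat.not_lt_zero _)
    | succ k ih =>
    intro A₀ hA₀ f₀ hf₀ hk₀
    obtain ⟨A, hA, f, hf, hinj, hrange⟩ := hclosed.exists_injective hA₀ hf₀
    have := (hF A₀ hA₀).1
    obtain ⟨hfin, hconn⟩ := hF A hA
    have hk : (Set.range f \ Set.range β₁).ncard < k + 1 :=
      (Set.ncard_le_ncard (Set.sdiff_subset_sdiff_left hrange) (Set.toFinite _)).trans_lt hk₀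
    -- Minimality in usable form: outside `W₁`, no member of `F` can be mapped into the image of `f`
    -- while missing a vertex `f z`. Injectivity of `f` ensures that `f z` is really missed.
    have hsmall : ∀ B ∈ F, ∀ g : B → D, IsHomEmb g → ∀ z : A, f z ∉ Set.range β₁ →
        (∀ b, g b ∈ Set.range β₁ ∨ ∃ x, x ≠ z ∧ f x = g b) → False := by
      intro B hB g hg z hz hb
      refine ih B hB g hg (lt_of_lt_of_le (Set.ncard_lt_ncard ⟨?_, fun hsub => ?_⟩ (Set.toFinite _))
        (Nat.lt_succ_iff.1 hk))
      · rintro _ ⟨⟨b, rfl⟩, hb'⟩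
        obtain ⟨x, -, hx⟩ := (hb b).resolve_left hb'
        exact ⟨⟨x, hx⟩, hb'⟩
      · obtain ⟨⟨b, hbz⟩, -⟩ := hsub ⟨⟨z, rfl⟩, hz⟩
        obtain ⟨x, hxz, hx⟩ := (hb b).resolve_left (hbz ▸ hz)
        exact hxz (hinj (hx.trans hbz))
    obtain ⟨z, hz⟩ := Forb.not_range_subset hA hf hW₁ β₁
    let R₀ : Set A := {x | ∃ a, β₁ (α₁ a) = f x}
    have hR₀ : ∀ x, f x ∈ Set.range β₁ → f x ∈ Set.range β₂ → x ∈ R₀ := by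
      rintro x ⟨b₁, hb₁⟩ ⟨b₂, hb₂⟩
      obtain ⟨a, rfl, -⟩ := h.1.2 b₁ b₂ (hb₁.trans hb₂.symm)
      exact ⟨a, hb₁⟩
    have hR₀₂ : ∀ x ∈ R₀, f x ∈ Set.range β₂ := by
      rintro x ⟨a, ha⟩
      exact ⟨α₂ a, (h.1.1 a).symm.trans ha⟩
    obtain ⟨C₀, hC₀, hzC₀⟩ := exists_isComponent (A := A) (R := R₀) (x := z) (by
      rintro ⟨a, ha⟩
      exact hz ⟨_, ha⟩)
    obtain ⟨hC₀c, hC₀R₀, -⟩ := isComponent_iff.1 hC₀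
    -- Adjacent vertices are mapped into a common part, and crossing from one part to the other
    -- would require passing through `R₀`.
    have hfC₀ : ∀ x ∈ C₀, f x ∉ Set.range β₁ := by
      have := hC₀c.2 {x | x ∈ C₀ ∧ f x ∉ Set.range β₁} (fun x hx => hx.1) ⟨z, hzC₀, hz⟩ (by
        rintro x ⟨-, hx⟩ y hy ⟨-, n, R, t, ht, ⟨i, rfl⟩, ⟨j, rfl⟩⟩
        refine ⟨hy, fun hy' => ?_⟩
        rcases h.range_or_range (hf.map_rel n R t ht) with ht' | ht'
        · exact hx (ht' i)
        · exact Set.disjoint_left.1 hC₀R₀ hy (hR₀ _ hy' (ht' j)))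
      exact fun x hx => (this hx).2
    have hNR := hC₀.neighbourhood_subset
    have hC₀₂ : ∀ x ∈ C₀, f x ∈ Set.range β₂ := fun x hx =>
      (h.2.1 (f x)).resolve_left (hfC₀ x hx)
    refine h.1.false_of_components hF hagree hW₂ _ A hA f hf C₀ hC₀c hC₀₂ hinj.injOn
      (fun x hx => hNR hx) (fun x hx => ?_) rfl
    obtain ⟨C, hC, hxC⟩ := exists_isComponent (A := A) (R := neighbourhood A C₀) (x := x)
      fun hx' => hx (hR₀₂ x (hNR hx'))
    refine ⟨C, hC, hxC, ?_⟩
    by_contra! hcon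
    obtain ⟨z', hz'C, hz'⟩ := hcon
    have hne : C ≠ C₀ := by
      rintro rfl
      exact hx (hC₀₂ x hxC)
    have hzC : z ∉ C := fun hzC => hne (hC.eq_of_mem hC₀c.isComponent_neighbourhood hzC hzC₀)
    have hRN := hC.neighbourhood_subset.trans hNR
    obtain ⟨n, c, t, ht, h₁, h₂⟩ := exists_exchange hA hfin hconn
      (isMinimalSeparating_neighbourhood hC₀c hC hne) hf hinj.injOn
    have hta : ∀ i, ∃ a, β₁ (α₁ a) = t i := fun i => by
      obtain ⟨y, hy, hyt⟩ := ht i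
      exact hyt ▸ hRN hy
    choose a ha using hta
    -- Adding the image of `C` to `W₁` creates no forbidden map, since `f z` is missed. This
    -- extension of `W₁` contains the piece on `C`, so by maximality the class of the piece is
    -- recorded in `W₁` itself.
    let S : Set D := Set.range β₁ ∪ f '' C
    have hS : induce D S ∈ Forb F := by
      have := hW₁.1
      have := hW₂.1
      have := h.countable
      refine ⟨(induceEmb D S).injective.countable, fun B hB ⟨g, hg⟩ => ?_⟩
      refine hsmall B hB _ (hg.embedding_comp (induceEmb D S)) z hz fun b => ?_
      rcases induceEmb_mem D S (g b) with hb | ⟨y, hy, hyb⟩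
      · exact Or.inl hb
      · exact Or.inr ⟨y, fun hyz => hzC (hyz ▸ hy), hyb⟩
    obtain ⟨e, he⟩ := exists_factor_embedding (induceEmb D S) β₁ fun w => by
      rw [range_induceEmb]
      exact Or.inl ⟨w, rfl⟩
    obtain ⟨s, hs, hcs⟩ := h₁ (induce D S) (induceEmb D S) (by
      rw [range_induceEmb]
      rintro y (hy | hy)
      · exact Or.inr ⟨y, hy, rfl⟩
      · obtain ⟨b, hb⟩ := hRN hy
        exact Or.inl ⟨_, hb⟩)
    have hsa : e ∘ (α₁ ∘ a) = s := funext fun i => (induceEmb D S).injective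
      ((he _).trans ((ha i).trans (congrFun hs i).symm))
    obtain ⟨A', hA', ι, g, hg, hgι, hgr, -⟩ := h₂ W₁ β₁ (α₁ ∘ a) (funext ha)
      ((hmax _ hS e n c (α₁ ∘ a) fun i => ⟨a i, rfl⟩).2 (hsa.symm ▸ hcs))
    -- After the exchange the image outside `W₁` no longer contains `f z'`, as `z'` belonged to the
    -- removed component.
    refine hsmall A' hA' g hg z' hz' fun b => ?_
    by_cases hb : b ∈ Set.range ι
    · obtain ⟨q, rfl⟩ := hb
      exact Or.inr ⟨induceEmb A Cᶜ q, fun hq => induceEmb_mem A Cᶜ q (hq ▸ hz'C), (hgι q).symm⟩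
    · exact Or.inl (hgr b hb)
  have := hW₁.1
  have := hW₂.1
  exact ⟨h.countable, fun A hA ⟨f, hf⟩ => key _ A hA f hf (Nat.lt_succ_self _)⟩

end Core

/-! ### Chains -/

theorem exists_seq_of_step {σ : Type*} {S : ℕ → σ → σ → Prop} (step : ∀ n s, ∃ s', S n s s')
    (s₀ : σ) : ∃ G : ℕ → σ, G 0 = s₀ ∧ ∀ n, S n (G n) (G (n + 1)) := by
  choose next hnext using step
  exact ⟨fun n => Nat.rec s₀ (fun n s => next n s) n, rfl, fun n => hnext n _⟩

theorem exists_chain_limit (G : ℕ → Str L) (e : ∀ n, G n ↪[L] G (n + 1)) :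
    ∃ (M : Str L) (ι : ∀ n, G n ↪[L] M), (∀ n x, ι (n + 1) (e n x) = ι n x) ∧
      ∀ x, ∃ n y, ι n y = x := by
  let f := FirstOrder.Language.DirectedSystem.natLERec (L := L) (G' := fun n => (G n : Type)) e
  refine ⟨⟨FirstOrder.Language.DirectLimit (fun n => (G n : Type)) f, inferInstance⟩,
    fun n => FirstOrder.Language.DirectLimit.of L ℕ (fun n => (G n : Type)) f n, fun n x => ?_,
    fun x => FirstOrder.Language.DirectLimit.exists_of x⟩
  have : e n x = f n (n + 1) (Nat.le_succ n) x := by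
    rw [FirstOrder.Language.DirectedSystem.coe_natLERec]
    exact (Nat.leRecOn_succ' (C := fun n => G n) (next := fun {k} => e k) x).symm
  rw [this]
  exact FirstOrder.Language.DirectLimit.of_f

section Chain

variable {G : ℕ → Str L} {e : ∀ n, G n ↪[L] G (n + 1)} {M : Str L} {ι : ∀ n, G n ↪[L] M}
  (hι : ∀ n x, ι (n + 1) (e n x) = ι n x) (hM : ∀ x, ∃ n y, ι n y = x)

include hM in
theorem countable_of_chain [∀ n, Countable (G n)] : Countable M := by
  have : Function.Surjective fun p : Σ n, G n => ι p.1 p.2 := fun x => by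
    obtain ⟨n, y, h⟩ := hM x
    exact ⟨⟨n, y⟩, h⟩
  exact this.countable

include hι hM in
theorem exists_range_subset_of_chain {X : Type*} [Finite X] (f : X → M) (k : ℕ) :
    ∃ n, k ≤ n ∧ ∀ x, f x ∈ Set.range (ι n) := by
  have hmono : Monotone fun n => Set.range (ι n) := monotone_nat_of_le_succ fun n => by
    rintro _ ⟨x, rfl⟩
    exact ⟨e n x, hι n x⟩
  choose n y hy using fun x => hM (f x)
  obtain ⟨m, hm⟩ := Set.Finite.bddAbove (Set.finite_range n)
  exact ⟨max k m, le_max_left _ _, fun x =>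
    hmono ((hm ⟨x, rfl⟩).trans (le_max_right _ _)) ⟨y x, hy x⟩⟩

end Chain

/-! ### Extensions with a maximal canonical lift -/

theorem InCanonicalLift.embedding {F : Set (Str L)} {A B : Str L} (e : A ↪[L] B) {n : ℕ}
    {c : PieceClass F n} {t : Fin n → A} (h : InCanonicalLift F A c t) :
    InCanonicalLift F B c (e ∘ t) := by
  obtain ⟨P, hP, f, hf, hft, ht⟩ := h
  exact ⟨P, hP, _, hf.embedding_comp e, by rw [← hft]; rfl, e.injective.comp ht⟩

theorem IsMaximalOn.mono {F : Set (Str L)} {A : Str L} {S T : Set A} (h : IsMaximalOn F A T)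
    (hST : S ⊆ T) : IsMaximalOn F A S :=
  fun C hC e n c t ht => h C hC e n c t fun i => hST (ht i)

/-- The pairs of a class and a tuple of `B` are enumerated; at each stage the current structure is
extended in `Forb F` so that the pair holds, if any extension achieves this. New tuples persist
under embeddings, and finite members of `F` would already be mapped to some stage, so the limit is
in `Forb F`. Any extension of the limit extends every stage, hence adds nothing on `B`. -/
theorem exists_isMaximalOn [L.IsRelational] {F : Set (Str L)} (hF : ∀ A ∈ F, Finite A)
    (hcount : Countable (Σ n, PieceClass F n)) {B : Str L} (hB : B ∈ Forb F) :
    ∃ B' ∈ Forb F, ∃ e : B ↪[L] B', IsMaximalOn F B' (Set.range e) := by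
  have := hB.1
  rcases isEmpty_or_nonempty (Σ p : (Σ n, PieceClass F n), Fin p.1 → B) with hemp | hne
  · refine ⟨B, hB, FirstOrder.Language.Embedding.refl L B, fun C _ e n c t _ => ?_⟩
    exact hemp.elim ⟨⟨n, c⟩, t⟩
  obtain ⟨p, hp⟩ := exists_surjective_nat (Σ p : (Σ n, PieceClass F n), Fin p.1 → B)
  let σ := {C : Σ C : Str L, B ↪[L] C // C.1 ∈ Forb F}
  obtain ⟨G, -, hG⟩ := exists_seq_of_step (σ := σ)
    (S := fun k s s' => ∃ f : s.1.1 ↪[L] s'.1.1, (∀ x, f (s.1.2 x) = s'.1.2 x) ∧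
      ∀ C ∈ Forb F, ∀ f' : s.1.1 ↪[L] C,
        InCanonicalLift F C (p k).1.2 (fun i => f' (s.1.2 ((p k).2 i))) →
          InCanonicalLift F s'.1.1 (p k).1.2 (fun i => s'.1.2 ((p k).2 i)))
    (fun k s => by
      by_cases h : ∃ C ∈ Forb F, ∃ f' : s.1.1 ↪[L] C,
        InCanonicalLift F C (p k).1.2 (fun i => f' (s.1.2 ((p k).2 i)))
      · obtain ⟨C, hC, f', h⟩ := h
        exact ⟨⟨⟨C, f'.comp s.1.2⟩, hC⟩, f', fun _ => rfl, fun _ _ _ _ => h⟩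
      · exact ⟨s, FirstOrder.Language.Embedding.refl L _, fun _ => rfl,
          fun C hC f' h' => (h ⟨C, hC, f', h'⟩).elim⟩)
    ⟨⟨B, FirstOrder.Language.Embedding.refl L B⟩, hB⟩
  choose e he hmax using hG
  obtain ⟨M, ι, hι, hM⟩ := exists_chain_limit (fun k => (G k).1.1) e
  have hG' : ∀ k, Countable (G k).1.1 := fun k => (G k).2.1
  have hιe : ∀ k x, ι k ((G k).1.2 x) = ι 0 ((G 0).1.2 x) := fun k x => by
    induction k with
    | zero => rfl
    | succ k ih => rw [← ih, ← he, hι]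
  refine ⟨M, ⟨countable_of_chain hM, fun A hA ⟨f, hf⟩ => ?_⟩, (ι 0).comp (G 0).1.2, ?_⟩
  · have := hF A hA
    obtain ⟨k, -, hk⟩ := exists_range_subset_of_chain hι hM f 0
    obtain ⟨g, hg, -⟩ := hf.exists_factor (ι k) hk
    exact (G k).2.2 A hA ⟨g, hg⟩
  · intro C hC f n c t ht
    refine ⟨fun h => h.embedding f, fun h => ?_⟩
    choose s hs using ht
    obtain ⟨k, hk⟩ := hp ⟨⟨n, c⟩, s⟩
    have hmk := hmax k C hC (f.comp (ι k))
    rw [hk] at hmk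
    have hts : ∀ k, (fun i => ι k ((G k).1.2 (s i))) = t := fun k =>
      funext fun i => (hιe k (s i)).trans (hs i)
    have := (hmk (by
      convert h using 1
      exact funext fun i => congrArg f (congrFun (hts k) i))).embedding (ι (k + 1))
    rwa [show ι (k + 1) ∘ (fun i => (G (k + 1)).1.2 (s i)) = t from hts (k + 1)] at this

/-! ### Existence of Fraïssé limits -/

section FraisseLimit

variable [L.IsRelational] {K : Set (Str L)}

/-- One stage of the Fraïssé construction: finitely many extension problems are solved by successive
amalgamation, and joint embedding adds the next isomorphism type. -/
theorem IsAmalgamationClass.exists_extend (hK : IsAmalgamationClass K) {D : Str L} (hD : D ∈ K)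
    (n : ℕ) (B : ℕ → Str L) (hB : ∀ k, B k ∈ K) :
    ∃ D' ∈ K, ∃ e : D ↪[L] D', Nonempty (B n ↪[L] D') ∧
      ∀ k ≤ n, ∀ (S : L.Substructure (B k)) (f : S ↪[L] D),
        ∃ g : B k ↪[L] D', ∀ x : S, g x = e (f x) := by
  classical
  have hfin := fun k => hK.finite (B k) (hB k)
  have := hK.finite D hD
  let T := Σ k : Fin (n + 1), Σ S : L.Substructure (B k), S ↪[L] D
  have : ∀ k, Finite (L.Substructure (B k)) := fun k =>
    Finite.of_injective (fun S : L.Substructure (B k) => (S : Set (B k))) SetLike.coe_injective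
  have : ∀ k (S : L.Substructure (B k)), Finite (S ↪[L] D) := fun k S =>
    DFunLike.finite _
  have : Finite T := inferInstance
  cases nonempty_fintype T
  have key : ∀ s : Finset T, ∃ D' ∈ K, ∃ e : D ↪[L] D', ∀ τ ∈ s,
      ∃ g : B τ.1 ↪[L] D', ∀ x : τ.2.1, g x = e (τ.2.2 x) := by
    intro s
    induction s using Finset.induction_on with
    | empty => exact ⟨D, hD, FirstOrder.Language.Embedding.refl L D, by simp⟩
    | insert τ s _ ih =>
      obtain ⟨D', hD', e, he⟩ := ih
      have hS : (⟨τ.2.1, inferInstance⟩ : Str L) ∈ K := hK.hereditary _ (hB τ.1)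
        ⟨FirstOrder.Language.Structure.fg_iff_finite.2 inferInstance,
          ⟨FirstOrder.Language.Substructure.subtype _⟩⟩
      obtain ⟨Q, g, e', hQ, hge⟩ := hK.amalgamation ⟨τ.2.1, inferInstance⟩ (B τ.1) D'
        (FirstOrder.Language.Substructure.subtype _) (e.comp τ.2.2) hS (hB _) hD'
      refine ⟨Q, hQ, e'.comp e, fun ρ hρ => ?_⟩
      rcases Finset.mem_insert.1 hρ with rfl | hρ
      · exact ⟨g, fun x => DFunLike.congr_fun hge x⟩
      · obtain ⟨g', hg'⟩ := he ρ hρ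
        exact ⟨e'.comp g', fun x => congrArg e' (hg' x)⟩
  obtain ⟨D', hD', e, he⟩ := key Finset.univ
  obtain ⟨Q, hQ, ⟨f₁⟩, ⟨f₂⟩⟩ := hK.jointEmbedding D' hD' (B n) (hB n)
  refine ⟨Q, hQ, f₁.comp e, ⟨f₂⟩, fun k hk S f => ?_⟩
  obtain ⟨g, hg⟩ := he ⟨⟨k, Nat.lt_succ_iff.2 hk⟩, S, f⟩ (Finset.mem_univ _)
  exact ⟨f₁.comp g, fun x => congrArg f₁ (hg x)⟩

/-- An amalgamation class of finite relational structures with countably many isomorphism types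
has a Fraïssé limit. -/
theorem IsAmalgamationClass.exists_isLimit (hK : IsAmalgamationClass K) (hne : K.Nonempty)
    (hc : EssentiallyCountable K) : ∃ U : Str L, IsLimit K U := by
  obtain ⟨q, hq⟩ := hc.exists_eq_range (hne.image _)
  have hB : ∀ k, ∃ B ∈ K, Quotient.mk FirstOrder.Language.equivSetoid B = q k := fun k => by
    have : q k ∈ Quotient.mk FirstOrder.Language.equivSetoid '' K := hq ▸ ⟨k, rfl⟩
    exact this
  choose B hBK hBq using hB
  have hrep : ∀ X ∈ K, ∃ k, Nonempty (X ≃[L] B k) := fun X hX => by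
    have : Quotient.mk FirstOrder.Language.equivSetoid X ∈ Set.range q := hq ▸ ⟨X, hX, rfl⟩
    obtain ⟨k, hk⟩ := this
    exact ⟨k, Quotient.exact ((hBq k).trans hk).symm⟩
  obtain ⟨D₀, hD₀⟩ := hne
  obtain ⟨G, -, hG⟩ := exists_seq_of_step (σ := K)
    (S := fun n D D' => ∃ e : D.1 ↪[L] D'.1, Nonempty (B n ↪[L] D'.1) ∧
      ∀ k ≤ n, ∀ (S : L.Substructure (B k)) (f : S ↪[L] D.1),
        ∃ g : B k ↪[L] D'.1, ∀ x : S, g x = e (f x))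
    (fun n D => by
      obtain ⟨D', hD', h⟩ := hK.exists_extend D.2 n B hBK
      exact ⟨⟨D', hD'⟩, h⟩) ⟨D₀, hD₀⟩
  choose e hBe hext using hG
  obtain ⟨M, ι, hι, hM⟩ := exists_chain_limit (fun k => (G k).1) e
  have hfin : ∀ k, Finite (G k).1 := fun k => hK.finite _ (G k).2
  have hcount : Countable M := countable_of_chain hM
  have hage : L.age M = K := by
    ext X
    constructor
    · rintro ⟨hX, ⟨f⟩⟩
      have := FirstOrder.Language.Structure.fg_iff_finite.1 hX
      obtain ⟨k, -, hk⟩ := exists_range_subset_of_chain hι hM f 0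
      obtain ⟨g, -⟩ := exists_factor_embedding (ι k) f hk
      exact hK.hereditary _ (G k).2 ⟨hX, ⟨g⟩⟩
    · intro hX
      obtain ⟨k, ⟨φ⟩⟩ := hrep X hX
      obtain ⟨g⟩ := hBe k
      exact ⟨FirstOrder.Language.Structure.fg_iff_finite.2 (hK.finite X hX),
        ⟨(ι (k + 1)).comp (g.comp φ.toEmbedding)⟩⟩
  refine ⟨M, hcount, ⟨?_, hage⟩⟩
  rw [FirstOrder.Language.isUltrahomogeneous_iff_IsExtensionPair
    FirstOrder.Language.Structure.cg_of_countable,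
    FirstOrder.Language.isExtensionPair_iff_exists_embedding_closure_singleton_sup]
  intro S hS f m
  have hT := (FirstOrder.Language.Substructure.fg_closure_singleton (L := L) m).sup hS
  have hTK := hage ▸ FirstOrder.Language.age.fg_substructure hT
  obtain ⟨k, ⟨φ⟩⟩ := hrep _ hTK
  have := FirstOrder.Language.Substructure.fg_iff_finite.1 hS
  -- The stage must contain the finite image of `f` and also come no earlier than `k`, so that the
  -- extension problems from `B k` are solved there.
  obtain ⟨n, hkn, hn⟩ := exists_range_subset_of_chain hι hM f k
  obtain ⟨f', hf'⟩ := exists_factor_embedding (ι n) f hn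
  let j : S ↪[L] B k := φ.toEmbedding.comp (FirstOrder.Language.Substructure.inclusion le_sup_right)
  obtain ⟨g, hg⟩ := hext n k hkn j.toHom.range (f'.comp j.equivRange.symm.toEmbedding)
  refine ⟨((ι (n + 1)).comp g).comp φ.toEmbedding, ?_⟩
  ext x
  have hx := hg (j.equivRange x)
  simp only [FirstOrder.Language.Embedding.comp_apply, FirstOrder.Language.Equiv.coe_toEmbedding,
    FirstOrder.Language.Equiv.symm_apply_apply] at hx
  have hjx : (j.equivRange x : B k) = φ (FirstOrder.Language.Substructure.inclusion le_sup_right x) :=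
    rfl
  rw [hjx] at hx
  rw [← hf', ← hι, ← hx]
  rfl

end FraisseLimit

/-! ### Lifts -/

section Lift

variable {F : Set (Str L)}

/-- The new relations of a lift. -/
def NewRel {n : ℕ} (X : Str (liftLang F)) (c : PieceClass F n) (t : Fin n → X) : Prop :=
  RelMap (L := liftLang F) (Sum.inr c : (liftLang F).Relations n) t

theorem newRel_embedding {X Y : Str (liftLang F)} (e : X ↪[liftLang F] Y) {n : ℕ}
    (c : PieceClass F n) (t : Fin n → X) : NewRel Y c (e ∘ t) ↔ NewRel X c t :=
  e.map_rel (Sum.inr c : (liftLang F).Relations n) t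

theorem IsMaximalLift.injective_of_newRel {X : Str (liftLang F)} (hX : IsMaximalLift F X) {n : ℕ}
    {c : PieceClass F n} {t : Fin n → X} (h : NewRel X c t) : Function.Injective t := by
  obtain ⟨A, -, e, -⟩ := hX
  obtain ⟨-, -, -, -, -, ht⟩ := (newRel_embedding e c t).2 h
  exact ht.of_comp

theorem IsMaximalLift.of_embedding {X Y : Str (liftLang F)} (hY : IsMaximalLift F Y)
    (e : X ↪[liftLang F] Y) : IsMaximalLift F X := by
  obtain ⟨A, hA, f, hf⟩ := hY
  exact ⟨A, hA, f.comp e, hf.mono (Set.range_comp_subset_range e f)⟩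

theorem mem_Lifts_of_embedding {X Y : Str (liftLang F)} (hY : Y ∈ Lifts F)
    (e : X ↪[liftLang F] Y) : X ∈ Lifts F := by
  have := hY.1
  exact ⟨Finite.of_injective e e.injective, hY.2.of_embedding e⟩

/-- There are no pieces of width zero. -/
theorem isEmpty_pieceClass_zero : IsEmpty (PieceClass F 0) := by
  refine ⟨fun c => ?_⟩
  obtain ⟨⟨P, A, hA, hconn, R, C, e, ⟨hC, -, C', hC', hne, -⟩, -, hR⟩, -⟩ := Quotient.exists_rep c
  obtain rfl : R = ∅ := by rw [← hR, Set.range_eq_empty]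
  obtain ⟨⟨⟨x, hx⟩, -⟩, -, hcl⟩ := isComponent_iff.1 hC
  obtain ⟨⟨⟨y, hy⟩, -⟩, -⟩ := isComponent_iff.1 hC'
  obtain ⟨p⟩ := hconn.preconnected x y
  -- With an empty cut a component is closed under adjacency, so connectedness leaves no room for a
  -- second one.
  have key : ∀ a b : A, (gaifman A).Walk a b → a ∈ C → b ∈ C := by
    intro a b p
    induction p with
    | nil => exact id
    | cons hab _ ih => exact fun ha => ih (hcl _ ha _ (Set.notMem_empty _) hab)
  exact hne (hC'.eq_of_mem hC hy (key x y p hx))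

variable [L.IsRelational]

/-- The embedding of shadows underlying an embedding of lifts. -/
def shadowEmb {X Y : Str (liftLang F)} (e : X ↪[liftLang F] Y) : shadow X ↪[L] shadow Y :=
  mkEmb (A := shadow X) (B := shadow Y) e e.injective fun _ R t =>
    e.map_rel (Sum.inl R : (liftLang F).Relations _) t

/-- The embedding of structures underlying an embedding into a canonical lift. -/
def canonicalEmb {X : Str (liftLang F)} {A : Str L} (e : X ↪[liftLang F] canonicalLift F A) :
    shadow X ↪[L] A :=
  mkEmb (A := shadow X) (B := A) e e.injective fun _ R t =>
    e.map_rel (Sum.inl R : (liftLang F).Relations _) t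

/-- An embedding of shadows that preserves and reflects the new relations is an embedding. -/
def liftEmb {X Y : Str (liftLang F)} (e : shadow X ↪[L] shadow Y)
    (h : ∀ (n : ℕ) (c : PieceClass F n) (t : Fin n → X), NewRel Y c (e ∘ t) ↔ NewRel X c t) :
    X ↪[liftLang F] Y :=
  mkEmb (A := X) (B := Y) e e.injective fun n R t => by
    cases R with
    | inl R => exact e.map_rel R t
    | inr c => exact h n c t

/-- The class of finite maximal lifts is hereditary, thus equal to its age. -/
theorem ageOf_Lifts : ageOf (Lifts F) = Lifts F := by
  ext X
  simp only [ageOf, Set.mem_iUnion]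
  constructor
  · rintro ⟨Y, hY, -, ⟨e⟩⟩
    exact mem_Lifts_of_embedding hY e
  · intro hX
    exact ⟨X, hX, FirstOrder.Language.Structure.fg_iff_finite.2 hX.1,
      ⟨FirstOrder.Language.Embedding.refl _ X⟩⟩

theorem IsMaximalLift.shadow_mem_Forb {X : Str (liftLang F)} (hX : IsMaximalLift F X) :
    shadow X ∈ Forb F := by
  obtain ⟨A, hA, e, -⟩ := hX
  exact Forb.of_embedding hA (canonicalEmb e)

/-- The members of `Forb(F)` are shadows of maximal lifts. -/
theorem exists_isMaximalLift (hF : ∀ A ∈ F, Finite A)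
    (hcount : Countable (Σ n, PieceClass F n)) {A : Str L} (hA : A ∈ Forb F) :
    ∃ A' ∈ Forb F, ∃ (e : A ↪[L] A') (X : Str (liftLang F)) (i : X ↪[liftLang F] canonicalLift F A')
      (φ : shadow X ≃[L] A), IsMaximalOn F A' (Set.range e) ∧ ∀ x, e (φ x) = i x := by
  obtain ⟨A', hA', e, he⟩ := exists_isMaximalOn hF hcount hA
  let X := induce (canonicalLift F A') (Set.range e)
  obtain ⟨φ, hφ⟩ := exists_factor_embedding e
    (canonicalEmb (induceEmb (canonicalLift F A') (Set.range e)))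
    fun x => induceEmb_mem (canonicalLift F A') _ x
  have hφs : Function.Surjective φ := fun a => by
    let x : X := (⟨e a, a, rfl⟩ : ↥(Set.range e))
    exact ⟨x, e.injective (hφ x)⟩
  let φ' : shadow X ≃ A := Equiv.ofBijective φ ⟨φ.injective, hφs⟩
  exact ⟨A', hA', e, X, induceEmb _ _, ⟨φ', fun g => isEmptyElim g, fun R t => φ.map_rel R t⟩,
    he, hφ⟩

theorem exists_mem_Lifts (hF : ∀ A ∈ F, Finite A)
    (hcount : Countable (Σ n, PieceClass F n)) {A : Str L} (hA : A ∈ Forb F) (hfin : Finite A) :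
    ∃ X ∈ Lifts F, Nonempty (shadow X ≃[L] A) := by
  obtain ⟨A', hA', e, X, i, φ, he, hi⟩ := exists_isMaximalLift hF hcount hA
  refine ⟨X, ⟨Finite.of_equiv A φ.toEquiv.symm, A', hA', i, he.mono ?_⟩, ⟨φ⟩⟩
  rintro _ ⟨x, rfl⟩
  exact ⟨φ x, hi x⟩

theorem nonempty_embedding_of_isEmpty [IsEmpty (L.Relations 0)] [IsEmpty (PieceClass F 0)]
    (X Y : Str (liftLang F)) [IsEmpty X] : Nonempty (X ↪[liftLang F] Y) := by
  refine ⟨mkEmb (fun x : X => isEmptyElim x) (fun x => isEmptyElim x) fun n R t => ?_⟩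
  cases n with
  | zero =>
    rcases R with R | R
    exacts [isEmptyElim R, isEmptyElim (α := PieceClass F 0) R]
  | succ n => exact isEmptyElim (t 0)

/-! ### The amalgamation class -/

section Amalgamation

variable (hF : ∀ A ∈ F, Finite A ∧ IsConnectedStr A)

include hF

/-- The witnesses of `B₁` and `B₂` induce the same lift on `A`, so their free amalgamation stays in
`Forb F`. A maximal extension of it is a witness for the lift induced on the union of the two
copies. -/
theorem hasAmalgamsWithFreeShadows_Lifts (hclosed : ClosedForHomEmbImages F)
    (hcount : Countable (Σ n, PieceClass F n)) : HasAmalgamsWithFreeShadows (Lifts F) := by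
  rintro A - B₁ ⟨hB₁, W₁, hW₁, e₁, he₁⟩ B₂ ⟨hB₂, W₂, hW₂, e₂, he₂⟩ α₁ α₂
  let a₁ : shadow A ↪[L] W₁ := canonicalEmb (e₁.comp α₁)
  let a₂ : shadow A ↪[L] W₂ := canonicalEmb (e₂.comp α₂)
  obtain ⟨D, γ₁, γ₂, hfree⟩ := exists_isFreeAmalgam a₁ a₂
  have hD : D ∈ Forb F := by
    refine hfree.mem_Forb hF (fun n c t h => ?_) hclosed hW₁ hW₂
      (he₁.mono (Set.range_comp_subset_range α₁ e₁))
    exact (newRel_embedding (e₂.comp α₂) c t).2 ((newRel_embedding (e₁.comp α₁) c t).1 h)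
  obtain ⟨D', hD', δ, hδ⟩ := exists_isMaximalOn (fun A hA => (hF A hA).1) hcount hD
  -- Maximality of `W₁` on `B₁` says that passing to `D'` does not change the new relations there.
  let b₁ : B₁ ↪[liftLang F] canonicalLift F D' :=
    liftEmb (Y := canonicalLift F D') ((δ.comp γ₁).comp (canonicalEmb e₁)) fun n c t =>
      (he₁ D' hD' (δ.comp γ₁) n c (e₁ ∘ t) fun i => ⟨t i, rfl⟩).symm.trans (newRel_embedding e₁ c t)
  let b₂ : B₂ ↪[liftLang F] canonicalLift F D' :=
    liftEmb (Y := canonicalLift F D') ((δ.comp γ₂).comp (canonicalEmb e₂)) fun n c t =>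
      (he₂ D' hD' (δ.comp γ₂) n c (e₂ ∘ t) fun i => ⟨t i, rfl⟩).symm.trans (newRel_embedding e₂ c t)
  have hb₁ : ∀ x, b₁ x = δ (γ₁ (e₁ x)) := fun x => rfl
  have hb₂ : ∀ x, b₂ x = δ (γ₂ (e₂ x)) := fun x => rfl
  let S : Set (canonicalLift F D') := Set.range b₁ ∪ Set.range b₂
  let j := induceEmb (canonicalLift F D') S
  have hj : Set.range j = S := range_induceEmb _ _
  obtain ⟨β₁, hβ₁⟩ := exists_factor_embedding j b₁ fun x => hj.symm.subset (Or.inl ⟨x, rfl⟩)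
  obtain ⟨β₂, hβ₂⟩ := exists_factor_embedding j b₂ fun x => hj.symm.subset (Or.inr ⟨x, rfl⟩)
  refine ⟨induce (canonicalLift F D') S, ⟨(Set.toFinite S).to_subtype, D', hD', j, hδ.mono ?_⟩, β₁,
    β₂, ⟨fun a => j.injective ?_, fun x₁ x₂ h => ?_⟩, ⟨fun a => j.injective ?_, fun x₁ x₂ h => ?_⟩,
    ?_, ?_⟩
  · rintro _ ⟨c, rfl⟩
    rcases hj.subset ⟨c, rfl⟩ with ⟨x, hx⟩ | ⟨x, hx⟩
    exacts [⟨_, hx⟩, ⟨_, hx⟩]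
  · rw [hβ₁, hβ₂, hb₁, hb₂]
    exact congrArg δ (hfree.1.1 a)
  · have := congrArg j h
    rw [hβ₁, hβ₂, hb₁, hb₂] at this
    obtain ⟨a, h₁, h₂⟩ := hfree.1.2 _ _ (δ.injective this)
    exact ⟨a, e₁.injective h₁, e₂.injective h₂⟩
  · rw [hβ₁, hβ₂, hb₁, hb₂]
    exact congrArg δ (hfree.1.1 a)
  · have := congrArg j h
    rw [hβ₁, hβ₂, hb₁, hb₂] at this
    obtain ⟨a, h₁, h₂⟩ := hfree.1.2 _ _ (δ.injective this)
    exact ⟨a, e₁.injective h₁, e₂.injective h₂⟩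
  · intro c
    rcases hj.subset ⟨c, rfl⟩ with ⟨x, hx⟩ | ⟨x, hx⟩
    · exact Or.inl ⟨x, j.injective ((hβ₁ x).trans hx)⟩
    · exact Or.inr ⟨x, j.injective ((hβ₂ x).trans hx)⟩
  · rintro n R t ht ⟨i, k, ⟨x, hx, hxi⟩, y, hy, hyk⟩
    have hjt : ∀ i, ∃ s, δ s = j (t i) := fun i => by
      rcases hj.subset ⟨t i, rfl⟩ with ⟨x, hx⟩ | ⟨x, hx⟩
      exacts [⟨_, hx⟩, ⟨_, hx⟩]
    choose s hs using hjt
    have hR : RelMap R s := by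
      have := (j.map_rel (Sum.inl R : (liftLang F).Relations n) t).2 ht
      have hst : (fun i => δ (s i)) = fun i => j (t i) := funext hs
      exact (δ.map_rel R s).1 ((congrArg (fun u => RelMap R u) hst).mpr this)
    have hsi : s i = γ₁ (e₁ x) := δ.injective (by
      rw [hs, ← hxi]
      exact hβ₁ x)
    have hsk : s k = γ₂ (e₂ y) := δ.injective (by
      rw [hs, ← hyk]
      exact hβ₂ y)
    rcases hfree.range_or_range hR with h | h
    · obtain ⟨w, hw⟩ := h k
      obtain ⟨a, -, ha⟩ := hfree.1.2 _ _ (hw.trans hsk)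
      exact hy ⟨a, e₂.injective ha⟩
    · obtain ⟨w, hw⟩ := h i
      obtain ⟨a, ha, -⟩ := hfree.1.2 _ _ (hsi.symm.trans hw.symm)
      exact hx ⟨a, e₁.injective ha⟩

/-- The empty structure admits no map from a non-empty one. Amalgamation over its lift yields joint
embedding. -/
theorem Lifts_nonempty (hcount : Countable (Σ n, PieceClass F n)) :
    ∃ X ∈ Lifts F, IsEmpty X := by
  let st : L.Structure Empty := { funMap := fun g => isEmptyElim g, RelMap := fun _ _ => False }
  obtain ⟨X, hX, ⟨φ⟩⟩ := exists_mem_Lifts (F := F) (fun A hA => (hF A hA).1) hcount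
    (A := ⟨Empty, st⟩) ⟨inferInstanceAs (Countable Empty), fun B hB ⟨f, _⟩ => by
      obtain ⟨x⟩ := (hF B hB).2.nonempty
      exact Empty.elim (f x)⟩ (inferInstanceAs (Finite Empty))
  exact ⟨X, hX, φ.toEquiv.isEmpty⟩

theorem isAmalgamationClass_Lifts [IsEmpty (L.Relations 0)] (hclosed : ClosedForHomEmbImages F)
    (hcount : Countable (Σ n, PieceClass F n)) : IsAmalgamationClass (Lifts F) where
  finite _ hA := hA.1
  hereditary _ hA _ hB := mem_Lifts_of_embedding hA hB.2.some
  jointEmbedding B₁ hB₁ B₂ hB₂ := by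
    obtain ⟨X, hX, hempty⟩ := Lifts_nonempty hF hcount
    have := isEmpty_pieceClass_zero (F := F)
    obtain ⟨α₁⟩ := nonempty_embedding_of_isEmpty X B₁
    obtain ⟨α₂⟩ := nonempty_embedding_of_isEmpty X B₂
    obtain ⟨C, hC, β₁, β₂, -⟩ := hasAmalgamsWithFreeShadows_Lifts hF hclosed hcount X hX B₁ hB₁ B₂
      hB₂ α₁ α₂
    exact ⟨C, hC, ⟨β₁⟩, ⟨β₂⟩⟩
  amalgamation A B₁ B₂ α₁ α₂ hA hB₁ hB₂ := by
    obtain ⟨C, hC, β₁, β₂, h, -⟩ := hasAmalgamsWithFreeShadows_Lifts hF hclosed hcount A hA B₁ hB₁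
      B₂ hB₂ α₁ α₂
    exact ⟨C, β₁, β₂, hC, FirstOrder.Language.Embedding.ext h.1⟩

end Amalgamation

end Lift

/-! ### Tuples of the same quantifier-free type -/

/-- Two tuples satisfy the same equalities and the same relations. -/
def SameType (L : FirstOrder.Language.{u, v}) {A B ι : Type*} [L.Structure A] [L.Structure B]
    (t : ι → A) (t' : ι → B) : Prop :=
  (∀ i j, t i = t j ↔ t' i = t' j) ∧
    ∀ (n : ℕ) (R : L.Relations n) (s : Fin n → ι),
      RelMap R (fun i => t (s i)) ↔ RelMap R fun i => t' (s i)

section SameType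

variable {A B C ι κ : Type*} [L.Structure A] [L.Structure B] [L.Structure C]

theorem SameType.trans {t : ι → A} {t' : ι → B} {t'' : ι → C} (h : SameType L t t')
    (h' : SameType L t' t'') : SameType L t t'' :=
  ⟨fun i j => (h.1 i j).trans (h'.1 i j), fun n R s => (h.2 n R s).trans (h'.2 n R s)⟩

theorem SameType.symm {t : ι → A} {t' : ι → B} (h : SameType L t t') : SameType L t' t :=
  ⟨fun i j => (h.1 i j).symm, fun n R s => (h.2 n R s).symm⟩

theorem SameType.comp {t : ι → A} {t' : ι → B} (h : SameType L t t') (f : κ → ι) :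
    SameType L (fun k => t (f k)) fun k => t' (f k) :=
  ⟨fun i j => h.1 (f i) (f j), fun n R s => h.2 n R (f ∘ s)⟩

theorem sameType_embedding (e : A ↪[L] B) (t : ι → A) : SameType L t fun i => e (t i) :=
  ⟨fun _ _ => e.injective.eq_iff.symm, fun _ R s => (e.map_rel R fun i => t (s i)).symm⟩

theorem sameType_equiv (e : A ≃[L] B) (t : ι → A) : SameType L t fun i => e (t i) :=
  sameType_embedding e.toEmbedding t

/-- Being a homomorphism-embedding depends only on the quantifier-free type of the image, read as a
tuple indexed by the source. -/
theorem SameType.isHomEmb {A B C : Str L} {f : A → B} {g : A → C} (h : SameType L f g)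
    (hf : IsHomEmb f) : IsHomEmb g where
  map_rel n R t ht := (h.2 n R t).1 (hf.map_rel n R t ht)
  injOn S hS x hx y hy hxy := hf.injOn S hS hx hy ((h.1 x y).2 hxy)
  reflect_rel S hS n R t htS ht := hf.reflect_rel S hS n R t htS ((h.2 n R t).2 ht)

variable [L.IsRelational]

/-- A map all of whose finite parts preserve the type is an embedding. -/
theorem exists_embedding_of_sameType (f : A → B)
    (h : ∀ E : Finset A, SameType L (fun x : E => (x : A)) fun x : E => f x) :
    ∃ e : A ↪[L] B, ∀ x, e x = f x := by
  classical
  refine ⟨mkEmb f (fun x y hxy => ?_) fun n R t => ?_, fun _ => rfl⟩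
  · exact ((h {x, y}).1 ⟨x, by simp⟩ ⟨y, by simp⟩).2 hxy
  · exact ((h (Finset.univ.image t)).2 n R fun i => ⟨t i, by simp⟩).symm

theorem SameType.exists_embedding {t : ι → A} {t' : ι → B} (h : SameType L t t') :
    ∃ f : FirstOrder.Language.Substructure.closure L (Set.range t) ↪[L] B,
      ∀ i, f ⟨t i, FirstOrder.Language.Substructure.subset_closure ⟨i, rfl⟩⟩ = t' i := by
  have hex : ∀ x : FirstOrder.Language.Substructure.closure L (Set.range t), ∃ i, t i = x :=
    fun x => (FirstOrder.Language.Substructure.mem_closure_iff_of_isRelational L (Set.range t) x).1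
      x.2
  choose j hj using hex
  refine ⟨mkEmb (fun x => t' (j x)) (fun x y hxy => ?_) fun n R s => ?_, fun i => ?_⟩
  · exact Subtype.ext ((hj x).symm.trans (((h.1 _ _).2 hxy).trans (hj y)))
  · refine (h.2 n R (fun i => j (s i))).symm.trans ?_
    rw [show (fun i => t (j (s i))) = fun i => (s i : A) from funext fun i => hj (s i)]
    rfl
  · exact (h.1 _ _).1 (hj _)

theorem SameType.exists_fgEquiv [Finite ι] {t : ι → A} {t' : ι → B} (h : SameType L t t') :
    ∃ g : L.FGEquiv A B, ∀ e : A ↪[L] B, g.1 ≤ e.toPartialEquiv → ∀ i, e (t i) = t' i := by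
  obtain ⟨f, hf⟩ := h.exists_embedding
  refine ⟨⟨⟨_, f.toHom.range, f.equivRange⟩,
    FirstOrder.Language.Substructure.fg_closure (Set.finite_range t)⟩, fun e ⟨_, he⟩ i => ?_⟩
  rw [← hf]
  exact DFunLike.congr_fun he ⟨t i, FirstOrder.Language.Substructure.subset_closure ⟨i, rfl⟩⟩

theorem isExtensionPair_of_age_subset {M N : Str L}
    (hM : L.IsUltrahomogeneous M) (h : ∀ X : Str L, Finite X → (X ↪[L] N) → Nonempty (X ↪[L] M)) :
    L.IsExtensionPair N M := by
  rw [FirstOrder.Language.isExtensionPair_iff_exists_embedding_closure_singleton_sup]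
  intro S hS f m
  have hT := (FirstOrder.Language.Substructure.fg_closure_singleton (L := L) m).sup hS
  have := FirstOrder.Language.Substructure.fg_iff_finite.1 hT
  have := h ⟨_, inferInstance⟩ this (FirstOrder.Language.Substructure.subtype
    (FirstOrder.Language.Substructure.closure L {m} ⊔ S))
  exact hM.extend_embedding ((FirstOrder.Language.Substructure.fg_iff_structure_fg S).1 hS) f
    (FirstOrder.Language.Substructure.inclusion le_sup_right)

/-- A countable structure embeds in an ultrahomogeneous structure, over a finite tuple, if all its
finite substructures do. -/
theorem exists_embedding_of_age_subset {M N : Str L} [Countable N] [Finite ι]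
    (hM : L.IsUltrahomogeneous M) (h : ∀ X : Str L, Finite X → (X ↪[L] N) → Nonempty (X ↪[L] M))
    {t : ι → N} {t' : ι → M} (ht : SameType L t t') : ∃ e : N ↪[L] M, ∀ i, e (t i) = t' i := by
  obtain ⟨g, hg⟩ := ht.exists_fgEquiv
  obtain ⟨e, he⟩ := FirstOrder.Language.embedding_from_cg
    FirstOrder.Language.Structure.cg_of_countable g (isExtensionPair_of_age_subset hM h)
  exact ⟨e, hg e he⟩

theorem exists_automorphism_of_sameType {M : Str L} [Finite ι] (hM : L.IsUltrahomogeneous M)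
    {t t' : ι → M} (ht : SameType L t t') : ∃ g : M ≃[L] M, ∀ i, g (t i) = t' i := by
  obtain ⟨f, hf⟩ := ht.exists_embedding
  obtain ⟨g, hg⟩ := hM _ (FirstOrder.Language.Substructure.fg_closure (Set.finite_range t)) f
  refine ⟨g, fun i => ?_⟩
  rw [← hf, hg]
  rfl

end SameType

/-! ### Existentially complete structures -/

section ExistentiallyComplete

open FirstOrder.Language FirstOrder.Language.BoundedFormula

/-- The literal `φ` or `¬ φ`, according to the truth of `p`. -/
noncomputable def literal {α : Type*} {n : ℕ} (p : Prop) (φ : L.BoundedFormula α n) :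
    L.BoundedFormula α n :=
  open Classical in if p then φ else φ.not

theorem realize_literal {α : Type*} {n : ℕ} {p : Prop} {φ : L.BoundedFormula α n} {M : Type*}
    [L.Structure M] {v : α → M} {xs : Fin n → M} :
    (literal p φ).Realize v xs ↔ (p ↔ φ.Realize v xs) := by
  unfold literal
  split_ifs with hp <;> simp [hp]

theorem isQF_literal {α : Type*} {n : ℕ} {p : Prop} {φ : L.BoundedFormula α n} (h : φ.IsQF) :
    (literal p φ).IsQF := by
  unfold literal
  split_ifs
  exacts [h, h.not]

theorem isQF_iInf {α β : Type*} {n : ℕ} [Finite β] {f : β → L.BoundedFormula α n}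
    (h : ∀ b, (f b).IsQF) : (BoundedFormula.iInf f).IsQF := by
  have key : ∀ l : List β, ((l.map f).foldr (· ⊓ ·) ⊤).IsQF := fun l => by
    induction l with
    | nil => exact IsQF.top
    | cons b l ih => exact (h b).inf ih
  exact key _

theorem isExistential_exs {α : Type*} : ∀ {n : ℕ} {φ : L.BoundedFormula α n},
    φ.IsExistential → φ.exs.IsExistential
  | 0, _, h => h
  | _ + 1, φ, h => isExistential_exs (φ := φ.ex) h.ex

/-- In an existentially complete structure, the type of every finite tuple of an extension is
realized, over the elements of the tuple in the structure. -/
theorem IsExistentiallyComplete.exists_sameType (hL : Finite (Σ n, L.Relations n))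
    {K : Set (Str L)} {V D : Str L} (hV : IsExistentiallyComplete K V) (hD : D ∈ K) (e : V ↪[L] D)
    {J : Type*} [Finite J] (q : J → D) :
    ∃ q' : J → V, SameType L q q' ∧ ∀ j v, q j = e v → q' j = v := by
  classical
  let k := Nat.card J
  let σ : J ≃ Fin k := Finite.equivFin J
  let x : Fin k → L.Term (V ⊕ Fin k) := fun i => Term.var (Sum.inr i)
  let r : Fin k → D := fun i => q (σ.symm i)
  -- The formula describes the type of `r`: `φ₁` decides the equalities, `φ₂` the relations (a
  -- finite conjunction, as the language is finite), and `φ₃` pins the entries that already come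
  -- from `V`.
  let φ₁ : L.BoundedFormula V k := BoundedFormula.iInf fun p : Fin k × Fin k =>
    literal (r p.1 = r p.2) ((x p.1).bdEqual (x p.2))
  let φ₂ : L.BoundedFormula V k :=
    BoundedFormula.iInf fun p : Σ R : (Σ n, L.Relations n), Fin R.1 → Fin k =>
      literal (RelMap p.1.2 fun i => r (p.2 i)) (p.1.2.boundedFormula fun i => x (p.2 i))
  let φ₃ : L.BoundedFormula V k := BoundedFormula.iInf fun p : {i : Fin k // ∃ v, r i = e v} =>
    (x p.1).bdEqual (Term.var (Sum.inl p.2.choose))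
  have hqf : (φ₁ ⊓ φ₂ ⊓ φ₃).IsQF :=
    ((isQF_iInf fun p => isQF_literal (IsAtomic.equal _ _).isQF).inf
      (isQF_iInf fun p => isQF_literal (IsAtomic.rel _ _).isQF)).inf
      (isQF_iInf fun p => (IsAtomic.equal _ _).isQF)
  have hreal : ∀ {M : Type} [L.Structure M] (w : V → M) (s : Fin k → M),
      (φ₁ ⊓ φ₂ ⊓ φ₃).Realize w s ↔ (SameType L r s ∧
        ∀ p : {i : Fin k // ∃ v, r i = e v}, s p.1 = w p.2.choose) := by
    intro M _ w s
    simp only [φ₁, φ₂, φ₃, realize_inf, BoundedFormula.realize_iInf, realize_literal, realize_bdEqual, realize_rel,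
      x, Term.realize_var, Sum.elim_inr, Sum.elim_inl]
    exact and_congr_left fun _ => ⟨fun h => ⟨fun i j => h.1 (i, j), fun n R t => h.2 ⟨⟨n, R⟩, t⟩⟩,
      fun h => ⟨fun p => h.1 p.1 p.2, fun p => h.2 _ p.1.2 p.2⟩⟩
  have hV' : (φ₁ ⊓ φ₂ ⊓ φ₃).exs.Realize (fun a => a) :=
    hV.2 D hD e _ (isExistential_exs hqf.isExistential) (realize_exs.2 ⟨r, (hreal _ _).2
      ⟨⟨fun _ _ => Iff.rfl, fun _ _ _ => Iff.rfl⟩, fun p => p.2.choose_spec⟩⟩)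
  obtain ⟨s, hs⟩ := realize_exs.1 hV'
  obtain ⟨hs₁, hs₂⟩ := (hreal _ _).1 hs
  refine ⟨fun j => s (σ j), ?_, fun j v hj => ?_⟩
  · have := hs₁.comp σ
    simpa only [r, Equiv.symm_apply_apply] using this
  · have hr : r (σ j) = e v := by simpa only [r, Equiv.symm_apply_apply] using hj
    have h : ∃ v, r (σ j) = e v := ⟨v, hr⟩
    exact (hs₂ ⟨σ j, h⟩).trans (e.injective (h.choose_spec.symm.trans hr))

end ExistentiallyComplete

/-! ### Embeddings into `ω`-categorical structures -/

section OmegaCategorical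

theorem IsOmegaCategorical.exists_finite {V : Str L} (hV : IsOmegaCategorical V) (J : Type*)
    [Finite J] : ∃ T : Set (J → V), T.Finite ∧
      ∀ t : J → V, ∃ g : V ≃[L] V, (fun j => g (t j)) ∈ T := by
  obtain ⟨T, hT, h⟩ := hV (Nat.card J)
  let σ : J ≃ Fin (Nat.card J) := Finite.equivFin J
  refine ⟨(fun t j => t (σ j)) '' T, hT.image _, fun t => ?_⟩
  obtain ⟨g, hg⟩ := h fun i => t (σ.symm i)
  exact ⟨g, _, hg, funext fun j => by simp only [Equiv.symm_apply_apply]⟩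

/-- A map `f` that extends, from the finite set `S`, to type-preserving maps of all finite
sets. -/
def FinitelyExtendable {U V : Str L} (S : Finset U) (f : U → V) : Prop :=
  ∀ E : Finset U, S ⊆ E → ∃ q : U → V, (∀ x ∈ S, q x = f x) ∧
    SameType L (fun x : E => (x : U)) fun x : E => q x

open Classical in
-- A compactness argument. Up to automorphisms of `V` there are finitely many candidates on `insert
-- m S`. If each were defeated by some finite set, a map that works on the union of these sets would
-- restrict to an undefeated candidate.
theorem FinitelyExtendable.exists_insert {U V : Str L} (hV : IsOmegaCategorical V) {S : Finset U}
    {f : U → V} (h : FinitelyExtendable S f) (m : U) :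
    ∃ f' : U → V, (∀ x ∈ S, f' x = f x) ∧ FinitelyExtendable (insert m S) f' := by
  by_contra! hcon
  obtain ⟨T, hT, horb⟩ := hV.exists_finite ↥(insert m S)
  have hbad : ∀ τ : ↥(insert m S) → V, ∃ E : Finset U, ∀ f' : U → V, (∀ x ∈ S, f' x = f x) →
      (∃ g : V ≃[L] V, ∀ x : ↥(insert m S), g (f' x) = τ x) →
        ¬ ∃ q : U → V, (∀ x ∈ insert m S, q x = f' x) ∧
          SameType L (fun x : E => (x : U)) fun x : E => q x := fun τ => by
    by_cases hτ : ∃ f' : U → V, (∀ x ∈ S, f' x = f x) ∧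
      ∃ g : V ≃[L] V, ∀ x : ↥(insert m S), g (f' x) = τ x
    · obtain ⟨f₀, hf₀, g₀, hg₀⟩ := hτ
      have hE := hcon f₀ hf₀
      unfold FinitelyExtendable at hE
      push Not at hE
      obtain ⟨E, -, hE⟩ := hE
      refine ⟨E, fun f' hf' ⟨g, hg⟩ ⟨q, hq, hqE⟩ => hE (fun x => g₀.symm (g (q x)))
        (fun x hx => ?_) ?_⟩
      · rw [hq x hx]
        exact g₀.injective (by rw [g₀.apply_symm_apply, hg ⟨x, hx⟩, hg₀ ⟨x, hx⟩])
      · exact (hqE.trans (sameType_equiv g _)).trans (sameType_equiv g₀.symm _)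
    · exact ⟨∅, fun f' hf' hg => (hτ ⟨f', hf', hg⟩).elim⟩
  choose E hE using hbad
  obtain ⟨q, hqf, hq⟩ := h (hT.toFinset.biUnion E ∪ S) Finset.subset_union_right
  obtain ⟨g, hg⟩ := horb fun x => q x
  refine hE _ q hqf ⟨g, fun x => rfl⟩ ⟨q, fun x _ => rfl, ?_⟩
  exact hq.comp fun x : E _ => ⟨x, Finset.mem_union_left _
    (Finset.mem_biUnion.2 ⟨_, hT.mem_toFinset.2 hg, x.2⟩)⟩

variable [L.IsRelational]

/-- A countable structure embeds in an `ω`-categorical structure, over a finite tuple, if all its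
finite substructures do. -/
theorem IsOmegaCategorical.exists_embedding {U V : Str L} [Countable U] (hV : IsOmegaCategorical V)
    {ι : Type*} [Finite ι] {t : ι → U} {t' : ι → V}
    (h : ∀ E : Finset U, ∃ q : E → V, SameType L (fun x : E => (x : U)) q ∧
      ∀ (x : E) (i : ι), (x : U) = t i → q x = t' i) :
    ∃ e : U ↪[L] V, ∀ i, e (t i) = t' i := by
  classical
  rcases isEmpty_or_nonempty U with hU | ⟨⟨u₀⟩⟩
  · obtain ⟨e, -⟩ := exists_embedding_of_sameType (L := L) (fun x : U => (isEmptyElim x : V))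
      fun E => ⟨fun i => isEmptyElim (i : U), fun n R s => by
        cases n with
        | zero =>
          obtain ⟨q, hq, -⟩ := h E
          convert hq.2 0 R s using 3
        | succ n => exact isEmptyElim (s 0 : U)⟩
    exact ⟨e, fun i => isEmptyElim (t i)⟩
  obtain ⟨q₀, -⟩ := h {u₀}
  -- An arbitrary value, used to make partial maps total outside the finite set considered.
  have v₀ : V := q₀ ⟨u₀, by simp⟩
  cases nonempty_fintype ι
  have htotal : ∀ E : Finset U, ∃ q : U → V, SameType L (fun x : E => (x : U)) (fun x : E => q x) ∧
      ∀ x ∈ E, ∀ i, x = t i → q x = t' i := fun E => by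
    obtain ⟨q, hq, hqt⟩ := h E
    have hqE : (fun x : E => if hx : (x : U) ∈ E then q ⟨x, hx⟩ else v₀) = q :=
      funext fun x => dif_pos x.2
    refine ⟨fun x => if hx : x ∈ E then q ⟨x, hx⟩ else v₀, hqE.symm ▸ hq, fun x hx i hxi => ?_⟩
    exact (dif_pos hx).trans (hqt ⟨x, hx⟩ i hxi)
  obtain ⟨f₀, -, hf₀⟩ := htotal (Finset.univ.image t)
  have hext : FinitelyExtendable (Finset.univ.image t) f₀ := fun E hE => by
    obtain ⟨q, hq, hqt⟩ := htotal E
    refine ⟨q, fun x hx => ?_, hq⟩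
    obtain ⟨i, -, rfl⟩ := Finset.mem_image.1 hx
    rw [hqt _ (hE hx) i rfl, hf₀ _ hx i rfl]
  have : Nonempty U := ⟨u₀⟩
  obtain ⟨p, hp⟩ := exists_surjective_nat U
  obtain ⟨G, hG₀, hG⟩ := exists_seq_of_step
    (σ := {s : Finset U × (U → V) // FinitelyExtendable s.1 s.2})
    (S := fun n s s' => p n ∈ s'.1.1 ∧ ∀ x ∈ s.1.1, x ∈ s'.1.1 ∧ s'.1.2 x = s.1.2 x)
    (fun n s => by
      obtain ⟨f', hf', hext'⟩ := s.2.exists_insert hV (p n)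
      exact ⟨⟨(_, f'), hext'⟩, Finset.mem_insert_self _ _, fun x hx =>
        ⟨Finset.mem_insert_of_mem hx, hf' x hx⟩⟩)
    ⟨(_, f₀), hext⟩
  have hmono : ∀ n k, ∀ x ∈ (G n).1.1, x ∈ (G (n + k)).1.1 ∧ (G (n + k)).1.2 x = (G n).1.2 x := by
    intro n k
    induction k with
    | zero => exact fun x hx => ⟨hx, rfl⟩
    | succ k ih =>
      intro x hx
      obtain ⟨h₁, h₂⟩ := ih x hx
      obtain ⟨h₃, h₄⟩ := (hG (n + k)).2 x h₁
      exact ⟨h₃, h₄.trans h₂⟩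
  have hmem : ∀ x, ∃ n, x ∈ (G n).1.1 := fun x => by
    obtain ⟨n, rfl⟩ := hp x
    exact ⟨n + 1, (hG n).1⟩
  choose N hN using hmem
  have hval : ∀ n, ∀ x ∈ (G n).1.1, (G n).1.2 x = (G (N x)).1.2 x := fun n x hx => by
    rw [← (hmono n (N x) x hx).2, Nat.add_comm, (hmono (N x) n x (hN x)).2]
  obtain ⟨e, he⟩ := exists_embedding_of_sameType (L := L) (fun x : U => (G (N x)).1.2 x) fun E => by
    have hE : E ⊆ (G (E.sup N)).1.1 := fun x hx => by
      obtain ⟨k, hk⟩ := Nat.exists_eq_add_of_le (Finset.le_sup (f := N) hx)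
      rw [hk]
      exact (hmono _ k x (hN x)).1
    obtain ⟨q, hqf, hq⟩ := (G (E.sup N)).2 _ (Finset.Subset.refl _)
    convert hq.comp (fun x : E => ⟨x, hE x.2⟩) using 2 with x
    rw [hqf _ (hE x.2), hval _ _ (hE x.2)]
  refine ⟨e, fun i => ?_⟩
  have hi : t i ∈ Finset.univ.image t := Finset.mem_image_of_mem _ (Finset.mem_univ i)
  have h0 := hval 0 (t i) (by rw [hG₀]; exact hi)
  rw [he, ← h0, hG₀]
  exact hf₀ _ hi i rfl

end OmegaCategorical

/-! ### Counting lifts -/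

section Counting

open FirstOrder.Language (equivSetoid)

variable {F : Set (Str L)}

/-- The lift of `A` with the new tuples in `S`. -/
def mkLift (A : Str L) {N : ℕ} (S : Set (Σ n : Fin (N + 1), PieceClass F n × (Fin n → A))) :
    Str (liftLang F) :=
  ⟨A, @FirstOrder.Language.sumStructure L (extLang F) A A.str
    { funMap := fun f => Empty.elim f
      RelMap := fun {n} c t => ∃ h : n < N + 1, (⟨⟨n, h⟩, (c, t)⟩ :
        Σ n : Fin (N + 1), PieceClass F n × (Fin n → A)) ∈ S }⟩

theorem IsRegular.finite_pieceClass (hF : IsRegular F) (n : ℕ) : Finite (PieceClass F n) := by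
  cases n with
  | zero =>
    have := isEmpty_pieceClass_zero (F := F)
    infer_instance
  | succ n => exact hF _ (Nat.succ_pos n)

/-- The structure on `Fin N` with the tuples in `S`. -/
def mkStr [L.IsRelational] {N : ℕ} (S : Set (Σ r : (Σ n, L.Relations n), Fin r.1 → Fin N)) :
    Str L :=
  ⟨Fin N, { funMap := fun f => isEmptyElim f, RelMap := fun R t => ⟨⟨_, R⟩, t⟩ ∈ S }⟩

variable [L.IsRelational]

/-- New tuples are injective, so their arity is at most the number of vertices. Only finitely many
arities matter, although there may be infinitely many new symbols. -/
theorem exists_equiv_mkLift {X : Str (liftLang F)}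
    (hX : ∀ (n : ℕ) (c : PieceClass F n) (t : Fin n → X), NewRel X c t → Function.Injective t)
    {A : Str L} (φ : shadow X ≃[L] A) {N : ℕ} [Finite A] (hN : Nat.card A ≤ N) :
    ∃ S : Set (Σ n : Fin (N + 1), PieceClass F n × (Fin n → A)),
      Nonempty (X ≃[liftLang F] mkLift A S) := by
  let ψ : X ≃ A := φ.toEquiv
  refine ⟨{p | NewRel X p.2.1 fun i => ψ.symm (p.2.2 i)}, ⟨⟨ψ, fun g => isEmptyElim g, ?_⟩⟩⟩
  intro n R t
  cases R with
  | inl R => exact φ.map_rel R t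
  | inr c =>
    have ht : (fun i => ψ.symm (ψ (t i))) = t := funext fun i => ψ.symm_apply_apply (t i)
    constructor
    · rintro ⟨_, h⟩
      have h' : NewRel X c fun i => ψ.symm (ψ (t i)) := h
      rwa [ht] at h'
    · intro h
      have hinj := hX n c t h
      have hn : n ≤ Nat.card A := by
        simpa using Nat.card_le_card_of_injective _ (ψ.injective.comp hinj)
      refine ⟨Nat.lt_succ_iff.2 (hn.trans hN), ?_⟩
      change NewRel X c fun i => ψ.symm (ψ (t i))
      rwa [ht]

theorem exists_equiv_mkStr {A : Str L} [Finite A] :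
    ∃ S : Set (Σ r : (Σ n, L.Relations n), Fin r.1 → Fin (Nat.card A)),
      Nonempty (A ≃[L] mkStr S) := by
  let σ : A ≃ Fin (Nat.card A) := Finite.equivFin A
  refine ⟨{p | RelMap p.1.2 fun i => σ.symm (p.2 i)}, ⟨⟨σ, fun g => isEmptyElim g, ?_⟩⟩⟩
  intro n R t
  have ht : (fun i => σ.symm (σ (t i))) = t := funext fun i => σ.symm_apply_apply (t i)
  change RelMap R (fun i => σ.symm (σ (t i))) ↔ _
  rw [ht]

theorem isPrecompactLift_Lifts (hF : ∀ A ∈ F, Finite A)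
    (hcount : Countable (Σ n, PieceClass F n)) (hreg : IsRegular F) :
    IsPrecompactLift (Lifts F) {A | Finite A ∧ A ∈ Forb F} := by
  have := hreg.finite_pieceClass
  refine ⟨fun A => ⟨fun hA => exists_mem_Lifts hF hcount hA.2 hA.1, fun ⟨X, hX, ⟨φ⟩⟩ => ?_⟩, ?_⟩
  · have : Finite (shadow X) := hX.1
    exact ⟨Finite.of_equiv _ φ.toEquiv, Forb.of_embedding hX.2.shadow_mem_Forb φ.symm.toEmbedding⟩
  · rintro A ⟨hA, -⟩
    refine (Set.finite_range fun S : Set (Σ n : Fin (Nat.card A + 1),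
      PieceClass F n × (Fin n → A)) => Quotient.mk equivSetoid (mkLift A S)).subset ?_
    rintro _ ⟨X, ⟨hX, ⟨φ⟩⟩, rfl⟩
    obtain ⟨S, hS⟩ := exists_equiv_mkLift (fun _ _ _ => hX.2.injective_of_newRel) φ le_rfl
    exact ⟨S, (Quotient.sound hS).symm⟩

theorem essentiallyCountable_Lifts (hreg : IsRegular F) (hL : Finite (Σ n, L.Relations n)) :
    EssentiallyCountable (Lifts F) := by
  have := hreg.finite_pieceClass
  let T := Σ N : ℕ, Σ S : Set (Σ r : (Σ n, L.Relations n), Fin r.1 → Fin N),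
    Set (Σ n : Fin (N + 1), PieceClass F n × (Fin n → mkStr S))
  have : ∀ N (S : Set (Σ r : (Σ n, L.Relations n), Fin r.1 → Fin N)), Finite (mkStr S) :=
    fun N _ => inferInstanceAs (Finite (Fin N))
  have : Countable T := inferInstance
  refine (Set.countable_range fun p : T =>
    Quotient.mk equivSetoid (mkLift (mkStr p.2.1) p.2.2)).mono ?_
  rintro _ ⟨X, hX, rfl⟩
  have : Finite (shadow X) := hX.1
  obtain ⟨S, ⟨φ⟩⟩ := exists_equiv_mkStr (A := shadow X)
  obtain ⟨S', hS'⟩ := exists_equiv_mkLift (fun _ _ _ => hX.2.injective_of_newRel) φ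
    (Nat.card_congr φ.toEquiv).symm.le
  exact ⟨⟨_, S, S'⟩, (Quotient.sound hS').symm⟩

end Counting

/-! ### The Fraïssé limit and its shadow -/

section Limit

variable {F : Set (Str L)}

theorem sameType_liftLang {X Y : Str (liftLang F)} {ι : Type*} {t : ι → X} {t' : ι → Y}
    (h : SameType L (A := shadow X) (B := shadow Y) t t')
    (hnew : ∀ (n : ℕ) (c : PieceClass F n) (s : Fin n → ι),
      NewRel X c (fun i => t (s i)) ↔ NewRel Y c fun i => t' (s i)) :
    SameType (liftLang F) t t' := by
  refine ⟨h.1, fun n R s => ?_⟩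
  cases R with
  | inl R => exact h.2 n R s
  | inr c => exact hnew n c s

/-- A piece is finite, so its map to an extension is a finite tuple; a tuple of the same type in
`V`, with the same root, is again a homomorphism-embedding. -/
theorem IsExistentiallyComplete.isMaximalOn (hF : ∀ A ∈ F, Finite A)
    (hL : Finite (Σ n, L.Relations n)) {V : Str L} (hV : IsExistentiallyComplete (Forb F) V) :
    IsMaximalOn F V Set.univ := by
  rintro C hC e n c t -
  refine ⟨fun h => h.embedding e, ?_⟩
  rintro ⟨P, hP, f, hf, hft, ht⟩
  obtain ⟨A, hA, -, -, -, eA, -⟩ := P.2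
  have := hF A hA
  have : Finite P.1.str := Finite.of_injective eA eA.injective
  obtain ⟨q, hq, hqt⟩ := hV.exists_sameType hL hC e f
  exact ⟨P, hP, q, hq.isHomEmb hf, funext fun i => hqt _ _ (congrFun hft i), ht.of_comp⟩

variable [L.IsRelational]

/-- The isomorphism of shadows underlying an isomorphism of lifts. -/
def shadowEquiv {X Y : Str (liftLang F)} (e : X ≃[liftLang F] Y) : shadow X ≃[L] shadow Y where
  toEquiv := e.toEquiv
  map_fun' := fun g => isEmptyElim g
  map_rel' := fun {n} R t => e.map_rel (Sum.inl R : (liftLang F).Relations n) t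

variable (hF : ∀ A ∈ F, Finite A ∧ IsConnectedStr A)
  (hcount : Countable (Σ n, PieceClass F n)) {U : Str (liftLang F)} (hU : IsLimit (Lifts F) U)

include hU

theorem IsLimit.mem_Lifts {X : Str (liftLang F)} [Finite X] (e : X ↪[liftLang F] U) :
    X ∈ Lifts F := by
  obtain ⟨_, -, hage⟩ := hU
  exact hage ▸ ⟨FirstOrder.Language.Structure.fg_iff_finite.2 inferInstance, ⟨e⟩⟩

theorem IsLimit.nonempty_embedding {X Y : Str (liftLang F)} (hX : IsMaximalLift F X) [Finite Y]
    (e : Y ↪[liftLang F] X) : Nonempty (Y ↪[liftLang F] U) := by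
  obtain ⟨_, -, hage⟩ := hU
  have : Y ∈ Lifts F := ⟨inferInstance, hX.of_embedding e⟩
  rw [← hage] at this
  exact this.2

theorem IsLimit.isUltrahomogeneous : (liftLang F).IsUltrahomogeneous U := by
  obtain ⟨_, h⟩ := hU
  exact h.ultrahomogeneous

theorem IsLimit.exists_embedding {X : Str (liftLang F)} [Countable X] (hX : IsMaximalLift F X)
    {ι : Type*} [Finite ι] {t : ι → X} {t' : ι → U} (h : SameType (liftLang F) t t') :
    ∃ e : X ↪[liftLang F] U, ∀ i, e (t i) = t' i :=
  exists_embedding_of_age_subset hU.isUltrahomogeneous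
    (fun _ _ e => hU.nonempty_embedding hX e) h

theorem IsLimit.shadow_mem_Forb (hF : ∀ A ∈ F, Finite A) : shadow U ∈ Forb F := by
  refine ⟨hU.1, fun A hA ⟨f, hf⟩ => ?_⟩
  have := hF A hA
  let j := induceEmb U (Set.range f)
  have : Finite (induce U (Set.range f)) := (Set.finite_range f).to_subtype
  obtain ⟨g, hg, -⟩ := hf.exists_factor (shadowEmb j) fun x =>
    (range_induceEmb U (Set.range f)).symm.subset ⟨x, rfl⟩
  exact (hU.mem_Lifts j).2.shadow_mem_Forb.2 A hA ⟨g, hg⟩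

include hF hcount

/-- Every finite part of the limit has a witness in the shadow of the limit. -/
theorem IsLimit.exists_witness {ι : Type*} [Finite ι] (t : ι → U) :
    ∃ W ∈ Forb F, ∃ (a : ι → W) (h : W ↪[L] shadow U), (∀ i, h (a i) = t i) ∧
      ∀ C ∈ Forb F, ∀ e : W ↪[L] C, ∀ (n : ℕ) (c : PieceClass F n) (s : Fin n → ι),
        NewRel U c (fun i => t (s i)) ↔ InCanonicalLift F C c fun i => e (a (s i)) := by
  let Y := induce U (Set.range t)
  have : Finite Y := (Set.finite_range t).to_subtype
  let j : Y ↪[liftLang F] U := induceEmb U (Set.range t)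
  let y : ι → Y := fun i => (⟨t i, i, rfl⟩ : ↥(Set.range t))
  obtain ⟨-, W, hW, e₀, he₀⟩ := hU.mem_Lifts j
  have hYW : ∀ (n : ℕ) (c : PieceClass F n) (s : Fin n → ι),
      NewRel U c (fun i => t (s i)) ↔ InCanonicalLift F W c fun i => e₀ (y (s i)) :=
    fun n c s => (newRel_embedding j c fun i => y (s i)).trans
      (newRel_embedding e₀ c fun i => y (s i)).symm
  have hWC : ∀ C ∈ Forb F, ∀ e : W ↪[L] C, ∀ (n : ℕ) (c : PieceClass F n) (s : Fin n → ι),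
      NewRel U c (fun i => t (s i)) ↔ InCanonicalLift F C c fun i => e (e₀ (y (s i))) :=
    fun C hC e n c s => (hYW n c s).trans (he₀ C hC e n c (fun i => e₀ (y (s i))) fun i => ⟨_, rfl⟩)
  -- The lift of `W` need not be maximal on all of `W`, so `W` is first made the shadow of a maximal
  -- lift `X`. This changes nothing on the tuple, where `W` was already maximal, so `X` embeds in
  -- `U` over it.
  obtain ⟨W', hW', i₀, X, i, φ, hmax, hi⟩ := exists_isMaximalLift (fun A hA => (hF A hA).1) hcount hW
  have : Countable X := by
    have := hW.1
    exact Function.Injective.countable (f := (φ : shadow X → W)) φ.injective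
  have hX : IsMaximalLift F X := ⟨W', hW', i, hmax.mono (by
    rintro _ ⟨x, rfl⟩
    exact ⟨φ x, hi x⟩)⟩
  have hLt : SameType L (A := shadow X) (B := shadow U) (fun i => φ.symm (e₀ (y i))) t :=
    (sameType_equiv φ.symm _).symm.trans
      ((sameType_embedding (canonicalEmb e₀) y).symm.trans (sameType_embedding (shadowEmb j) y))
  obtain ⟨f, hf⟩ := hU.exists_embedding hX (sameType_liftLang hLt fun n c s => by
    refine (newRel_embedding i c fun k => φ.symm (e₀ (y (s k)))).symm.trans
      (Iff.trans ?_ (hWC W' hW' i₀ n c s).symm)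
    have : (i ∘ fun k => φ.symm (e₀ (y (s k)))) = fun k => i₀ (e₀ (y (s k))) := funext fun k =>
      (hi _).symm.trans (congrArg i₀ (φ.apply_symm_apply _))
    rw [this]
    rfl)
  exact ⟨W, hW, fun i => e₀ (y i), (shadowEmb f).comp φ.symm.toEmbedding, hf, hWC⟩

/-- The limit is the canonical lift of its shadow, and it is maximal. -/
theorem IsLimit.newRel_iff {C : Str L} (hC : C ∈ Forb F) (e : shadow U ↪[L] C) {n : ℕ}
    (c : PieceClass F n) (t : Fin n → U) : NewRel U c t ↔ InCanonicalLift F C c fun i => e (t i) := by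
  obtain ⟨W, hW, a, h, hat, hmax⟩ := hU.exists_witness hF hcount t
  refine (hmax C hC (e.comp h) n c id).trans ?_
  rw [show (fun i => e.comp h (a (id i))) = fun i => e (t i) from
    funext fun i => congrArg e (hat i)]

theorem IsLimit.newRel_iff_inCanonicalLift {n : ℕ} (c : PieceClass F n) (t : Fin n → U) :
    NewRel U c t ↔ InCanonicalLift F (shadow U) c t :=
  hU.newRel_iff hF hcount (hU.shadow_mem_Forb fun A hA => (hF A hA).1)
    (FirstOrder.Language.Embedding.refl L _) c t

/-- Extensions of a part of the shadow of the limit in `Forb(F)` are embedded in the shadow, over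
a finite tuple. -/
theorem IsLimit.exists_embedding_shadow {B : Str L} (hB : B ∈ Forb F) {ι : Type*} [Finite ι]
    (t : ι → U) (b : ι → B) (h : SameType L (B := shadow U) b t)
    (hnew : ∀ C ∈ Forb F, ∀ e : B ↪[L] C, ∀ (n : ℕ) (c : PieceClass F n) (s : Fin n → ι),
      NewRel U c (fun i => t (s i)) ↔ InCanonicalLift F C c fun i => e (b (s i))) :
    ∃ g : B ↪[L] shadow U, ∀ i, g (b i) = t i := by
  obtain ⟨B', hB', i₀, X, i, φ, hmax, hi⟩ := exists_isMaximalLift (fun A hA => (hF A hA).1) hcount hB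
  have : Countable X := by
    have := hB.1
    exact Function.Injective.countable (f := (φ : shadow X → B)) φ.injective
  have hX : IsMaximalLift F X := ⟨B', hB', i, hmax.mono (by
    rintro _ ⟨x, rfl⟩
    exact ⟨φ x, hi x⟩)⟩
  have hLt : SameType L (A := shadow X) (B := shadow U) (fun i => φ.symm (b i)) t :=
    (sameType_equiv φ.symm _).symm.trans h
  obtain ⟨f, hf⟩ := hU.exists_embedding hX (sameType_liftLang hLt fun n c s => by
    refine (newRel_embedding i c fun k => φ.symm (b (s k))).symm.trans
      (Iff.trans ?_ (hnew B' hB' i₀ n c s).symm)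
    have : (i ∘ fun k => φ.symm (b (s k))) = fun k => i₀ (b (s k)) := funext fun k =>
      (hi _).symm.trans (congrArg i₀ (φ.apply_symm_apply _))
    rw [this]
    rfl)
  exact ⟨(shadowEmb f).comp φ.symm.toEmbedding, hf⟩

theorem IsLimit.isUniversal [IsEmpty (L.Relations 0)] : IsUniversal (Forb F) (shadow U) := by
  intro B hB
  have := isEmpty_pieceClass_zero (F := F)
  obtain ⟨g, -⟩ := hU.exists_embedding_shadow hF hcount hB (ι := Empty) Empty.elim Empty.elim
    ⟨fun i => i.elim, fun n R s => by
      cases n with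
      | zero => exact isEmptyElim R
      | succ n => exact (s 0).elim⟩ fun C _ e n c s => by
      cases n with
      | zero => exact isEmptyElim c
      | succ n => exact (s 0).elim
  exact ⟨g⟩

open Classical in
-- A formula has finitely many parameters; over these the extension `B` embeds back into the shadow,
-- and existential formulas are preserved by embeddings.
theorem IsLimit.isExistentiallyComplete : IsExistentiallyComplete (Forb F) (shadow U) := by
  refine ⟨hU.shadow_mem_Forb fun A hA => (hF A hA).1, fun B hB e φ hφ hreal => ?_⟩
  obtain ⟨g, hg⟩ := hU.exists_embedding_shadow hF hcount hB
    (fun i : φ.freeVarFinset => (i : shadow U)) (fun i => e i) (sameType_embedding e _).symm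
    fun C hC e' n c s => hU.newRel_iff hF hcount hC (e'.comp e) c fun i => (s i).1
  have h := hφ.realize_embedding g hreal
  have h' := (FirstOrder.Language.BoundedFormula.realize_restrictFreeVar (φ := φ) (f := id)
    (v := fun i : φ.freeVarFinset => (i : shadow U)) (fun a => g (e a)) fun a => (hg a).symm).2 h
  refine (FirstOrder.Language.BoundedFormula.realize_restrictFreeVar (φ := φ) (f := id)
    (v := fun i : φ.freeVarFinset => (i : shadow U)) _ fun a => rfl).1 ?_
  convert h' using 1

/-- By ultrahomogeneity the orbit of a tuple is determined by its type in the lifted language. New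
tuples are injective, so only the new symbols of arity at most `n` count, and `code` takes finitely
many values. -/
theorem IsLimit.isOmegaCategorical (hreg : IsRegular F) (hL : Finite (Σ n, L.Relations n)) :
    IsOmegaCategorical (shadow U) := by
  intro n
  have := hreg.finite_pieceClass
  let code : (Fin n → U) → Set (Fin n × Fin n) ×
      Set (Σ r : (Σ m, L.Relations m), Fin r.1 → Fin n) ×
      Set (Σ m : Fin (n + 1), PieceClass F m × (Fin m → Fin n)) := fun t =>
    ({p | t p.1 = t p.2}, {p | RelMap (M := shadow U) p.1.2 fun i => t (p.2 i)},
      {p | NewRel U p.2.1 fun i => t (p.2.2 i)})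
  have hinj : ∀ (m : ℕ) (c : PieceClass F m) (t : Fin n → U) (s : Fin m → Fin n),
      NewRel U c (fun i => t (s i)) → m < n + 1 := fun m c t s h => by
    obtain ⟨-, -, -, -, -, ht⟩ := (hU.newRel_iff_inCanonicalLift hF hcount _ _).1 h
    have hs : Function.Injective s := fun i j hij => ht (congrArg t hij)
    simpa using Nat.lt_succ_of_le (Fintype.card_le_of_injective s hs)
  have htype : ∀ t t', code t = code t' → SameType (liftLang F) t t' := by
    intro t t' h
    simp only [code, Prod.mk.injEq] at h
    obtain ⟨h₁, h₂, h₃⟩ := h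
    refine sameType_liftLang ⟨fun i j => ?_, fun m R s => ?_⟩ fun m c s => ?_
    · exact Set.ext_iff.1 h₁ (i, j)
    · exact Set.ext_iff.1 h₂ ⟨⟨m, R⟩, s⟩
    · refine ⟨fun h => ?_, fun h => ?_⟩
      · exact (Set.ext_iff.1 h₃ ⟨⟨m, hinj m c t s h⟩, c, s⟩).1 h
      · exact (Set.ext_iff.1 h₃ ⟨⟨m, hinj m c t' s h⟩, c, s⟩).2 h
  refine ⟨Set.range fun κ : Set.range code => κ.2.choose, Set.finite_range _, fun t => ?_⟩
  have hκ : ∃ t', code t' = code t := ⟨t, rfl⟩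
  obtain ⟨g, hg⟩ := exists_automorphism_of_sameType hU.isUltrahomogeneous
    (htype t _ hκ.choose_spec.symm)
  exact ⟨shadowEquiv g, ⟨code t, hκ⟩, funext fun i => (hg i).symm⟩

theorem IsLimit.nonempty_equiv_shadow [IsEmpty (L.Relations 0)]
    (hclosed : ClosedForHomEmbImages F) (hL : Finite (Σ n, L.Relations n)) {V : Str L}
    (hVcat : IsOmegaCategorical V) (hV : IsExistentiallyComplete (Forb F) V) :
    Nonempty (V ≃[L] shadow U) := by
  have hfin : ∀ A ∈ F, Finite A := fun A hA => (hF A hA).1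
  have hUF := hU.shadow_mem_Forb hfin
  have hcU : Countable U := hU.1
  have hcU' : Countable (shadow U) := hU.1
  have hcV : Countable (canonicalLift F V) := hV.1.1
  have hVmax := hV.isMaximalOn hfin hL
  have hVlift : IsMaximalLift F (canonicalLift F V) :=
    ⟨V, hV.1, FirstOrder.Language.Embedding.refl _ _, hVmax.mono (Set.subset_univ _)⟩
  -- The harder direction of the back-and-forth: the whole of `U` embeds in the lift of `V` over any
  -- matching finite tuple.
  have hUV : ∀ {ι : Type} [Finite ι] (t : ι → U) (t' : ι → canonicalLift F V),
      SameType (liftLang F) t t' → ∃ e : U ↪[liftLang F] canonicalLift F V, ∀ i, e (t i) = t' i := by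
    intro ι _ t t' htt'
    have hL' : SameType L (A := V) (B := shadow U) t' t :=
      ⟨fun i j => (htt'.1 i j).symm, fun n R s =>
        (htt'.2 n (Sum.inl R : (liftLang F).Relations n) s).symm⟩
    let A := induce V (Set.range t')
    let y : ι → A := fun i => (⟨t' i, i, rfl⟩ : ↥(Set.range t'))
    have hy : ∀ a : A, ∃ i, y i = a := by
      rintro ⟨_, i, rfl⟩
      exact ⟨i, rfl⟩
    let α₁ : A ↪[L] V := induceEmb V (Set.range t')
    have hyt : SameType L (B := shadow U) y t := (sameType_embedding α₁ y).trans hL'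
    choose k hk using hy
    let α₂ : A ↪[L] shadow U := mkEmb (A := A) (B := shadow U) (fun a => t (k a))
      (fun a b hab => by
        rw [← hk a, ← hk b]
        exact (hyt.1 _ _).2 hab)
      fun n R s => by
        refine (hyt.2 n R fun i => k (s i)).symm.trans ?_
        rw [show (fun i => y (k (s i))) = s from funext fun i => hk (s i)]
    have hα₂ : ∀ i, α₂ (y i) = t i := fun i => (hyt.1 _ _).1 (hk (y i))
    obtain ⟨D, γ₁, γ₂, hfree⟩ := exists_isFreeAmalgam α₁ α₂
    have hD : D ∈ Forb F := by
      refine hfree.mem_Forb hF (fun n c s h => ?_) hclosed hV.1 hUF (hVmax.mono (Set.subset_univ _))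
      refine (hU.newRel_iff_inCanonicalLift hF hcount _ _).1 ?_
      refine (htt'.2 n (Sum.inr c : (liftLang F).Relations n) fun i => k (s i)).2 ?_
      have : (fun i => t' (k (s i))) = α₁ ∘ s := funext fun i => congrArg α₁ (hk (s i))
      rw [this]
      exact h
    -- Existential completeness copies each finite part of the shadow from `D` into `V`, fixing the
    -- entries of `t'`; `ω`-categoricity assembles the copies into one embedding.
    obtain ⟨e, he⟩ := hVcat.exists_embedding (U := shadow U) (t := t) (t' := t') fun E => by
      obtain ⟨q, hq, hqe⟩ := hV.exists_sameType hL hD γ₁ fun x : E => γ₂ x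
      refine ⟨q, (sameType_embedding γ₂ _).trans hq, fun x i hx => hqe _ _ ?_⟩
      rw [hx, ← hα₂]
      exact (hfree.1.1 (y i)).symm
    exact ⟨liftEmb (Y := canonicalLift F V) e fun n c s => (hU.newRel_iff hF hcount hV.1 e c s).symm,
      he⟩
  have hext₁ : (liftLang F).IsExtensionPair U (canonicalLift F V) := by
    rw [FirstOrder.Language.isExtensionPair_iff_exists_embedding_closure_singleton_sup]
    intro S hS f m
    have := FirstOrder.Language.Substructure.fg_iff_finite.1 hS
    obtain ⟨e, he⟩ := hUV (fun x : S => (x : U)) (fun x => f x)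
      ((sameType_embedding S.subtype fun x => x).symm.trans (sameType_embedding f fun x => x))
    refine ⟨e.comp (FirstOrder.Language.Substructure.subtype _), ?_⟩
    ext x
    exact (he x).symm
  have hext₂ : (liftLang F).IsExtensionPair (canonicalLift F V) U :=
    isExtensionPair_of_age_subset hU.isUltrahomogeneous fun _ _ e => hU.nonempty_embedding hVlift e
  have : IsEmpty (liftLang F).Constants := inferInstanceAs (IsEmpty ((liftLang F).Functions 0))
  have : IsEmpty ((liftLang F).Relations 0) := by
    have := isEmpty_pieceClass_zero (F := F)
    exact inferInstanceAs (IsEmpty (L.Relations 0 ⊕ PieceClass F 0))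
  -- The back-and-forth starts from `default`, the partial isomorphism between empty substructures,
  -- available since there are neither constants nor nullary relations.
  obtain ⟨φ, -⟩ := FirstOrder.Language.equiv_between_cg
    FirstOrder.Language.Structure.cg_of_countable FirstOrder.Language.Structure.cg_of_countable
    default hext₁ hext₂
  exact ⟨(shadowEquiv φ).symm⟩

end Limit

end MaximalLifts

open MaximalLifts in
theorem theorem3p2 {L : FirstOrder.Language.{u, v}} [L.IsRelational] [IsEmpty (L.Relations 0)]
    (F : Set (Str L))
    (hF : ∀ A ∈ F, Finite A ∧ IsConnectedStr A)
    (hclosed : ClosedForHomEmbImages F)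
    (hcount : Countable (Σ n, PieceClass F n)) :
    IsAmalgamationClass (ageOf (Lifts F)) ∧
    HasAmalgamsWithFreeShadows (ageOf (Lifts F)) ∧
    (IsRegular F →
      (∀ n, Finite ((extLang F).Relations n)) ∧
      IsPrecompactLift (ageOf (Lifts F)) {A | Finite A ∧ A ∈ Forb F}) ∧
    (EssentiallyCountable (Lifts F) →
      ∃ U' : Str (liftLang F), IsLimit (ageOf (Lifts F)) U') ∧
    (IsRegular F → Finite (Σ n, L.Relations n) →
      EssentiallyCountable (Lifts F) ∧
      ∀ U' : Str (liftLang F), IsLimit (ageOf (Lifts F)) U' →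
        shadow U' ∈ Forb F ∧
        IsOmegaCategorical (shadow U') ∧
        IsExistentiallyComplete (Forb F) (shadow U') ∧
        IsUniversal (Forb F) (shadow U') ∧
        ∀ V ∈ Forb F, IsOmegaCategorical V → IsExistentiallyComplete (Forb F) V →
          IsUniversal (Forb F) V → Nonempty (V ≃[L] shadow U')) := by
  have hfin : ∀ A ∈ F, Finite A := fun A hA => (hF A hA).1
  have hclass := isAmalgamationClass_Lifts hF hclosed hcount
  simp only [ageOf_Lifts]
  refine ⟨hclass, hasAmalgamsWithFreeShadows_Lifts hF hclosed hcount,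
    fun hreg => ⟨hreg.finite_pieceClass, isPrecompactLift_Lifts hfin hcount hreg⟩, fun hc => ?_,
    fun hreg hL => ⟨essentiallyCountable_Lifts hreg hL, fun U' hU => ⟨hU.shadow_mem_Forb hfin,
      hU.isOmegaCategorical hF hcount hreg hL, hU.isExistentiallyComplete hF hcount,
      hU.isUniversal hF hcount, fun V _ hVcat hV _ =>
        hU.nonempty_equiv_shadow hF hcount hclosed hL hVcat hV⟩⟩⟩
  obtain ⟨X, hX, -⟩ := Lifts_nonempty hF hcount
  exact hclass.exists_isLimit ⟨X, hX⟩ hc
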